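/- **Theorem 3.** *Setting.* For $T_0>0$ and $\beta\in[0,1]$ let $\phi_{T_0,\beta}$ be the root raised cosine (RRC) pulse: $\phi_{T_0,\beta}(t)=\sqrt{(1+\beta)/T_0}$ for $|t|\le \frac{1-\beta}{1+\beta}\frac{T_0}{2}$, $\phi_{T_0,\beta}(t)=\sqrt{\frac{1+\beta}{2T_0}\big(1+\cos\big[\frac{\pi(1+\beta)}{T_0\beta}\big(|t|-\frac{1-\beta}{1+\beta}\frac{T_0}{2}\big)\big]\big)}$ for $\frac{1-\beta}{1+\beta}\frac{T_0}{2}<|t|\le \frac{T_0}{2}$, and $0$ otherwise; $\widehat{\phi}_{T_0,\beta}$ is its Fourier transform, $\widehat x(f)=\int x(t)e^{-2\pi \mathrm{j} ft}\,dt$. A spectral mask $\mathcal S_W$ consists of $l\ge 1$, a bandwidth $W>0$, and non-decreasing real sequences $(U_i),(\alpha_i),(\eta_i)$, $1\le i\le l$; put $V_i=10^{-U_i/10}$. A function $E\ge 0$ (an energy spectral density) fits into $\mathcal S_W$ if for every $i$: $E(f)<V_i\sup_{f'}E(f')$ for all $f\ge\alpha_iW$, and $\int_{[-\alpha_iW,\alpha_iW]}E\ge\eta_i\int_{\mathbb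 R}E$. Call $T_0>0$ feasible for $\beta$ if for every $i$: $|\widehat\phi_{T_0,\beta}(f)|^2<V_i|\widehat\phi_{T_0,\beta}(0)|^2$ for all $f\ge \alpha_iW$, and $\int_{[-\alpha_iW,\alpha_iW]}|\widehat\phi_{T_0,\beta}|^2\ge\eta_i$. Let $c(\beta)=W\cdot\inf\{T_0: T_0 \text{ feasible for }\beta\}\in[0,\infty]$ and $c_{\min}=\inf_{\beta\in[0,1]}c(\beta)$ (the paper's $\min_\beta c(\beta)$). A code for duration $T$ has $M\ge 1$ messages, $K\ge 1$ keys, $n$ orthonormal carriers $g_1,\dots,g_n\in L^2$ supported in $[0,T]$, and discrete-time codewords $\mathbf x_{ms}\in\mathbb R^n$, with signals $x_{ms}(t)=\sum_i x_{ms,i}\,g_i(t)$ and code energy spectral density $\widehat E(f)=\frac1{MK}\sum_{m,s}|\widehat x_{ms}(f)|^2$. It is a BPSK/RRC code if for some $T_0>0$, $\beta\in[0,1]$, $a>0$ we have $n=\lfloor T/T_0\rfloor$, $g_i(t)=\phi_{T_0,\beta}(t-(i-\tfrac12)T_0)$, and all $x_{ms,i}\in\{-a,a\}$. The receiver knows the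 key $s$ and observes $Y(t)=X(t)+B(t)$, with $B$ white Gaussian noise of intensity $N_b/2$, and applies a decoder with values in $\{0,1,\dots,M\}$ to $Y$ (that is, to its linear functionals $\int Yg$, $g\in L^2$) and $s$; with message and key uniform, $$P_{\mathrm{err}}=\max_s\mathbb P(\widehat M\ne M\mid S=s,\ X=x_{Ms})+\mathbb P(\widehat M\ne0\mid X=0).$$ For the warden let $Q_0^{\otimes n}=\mathcal N(0,\tfrac{N_w}{2})^{\otimes n}$ and $\widehat Q=\frac1{MK}\sum_{m,s}\bigotimes_{i=1}^n\mathcal N(x_{ms,i},\tfrac{N_w}2)$. *Claim.* Let $\mathcal S_W$ be a spectral mask for which some $(T_0,\beta)$ with $T_0>0$, $\beta\in[0,1]$ is feasible and $c_{\min}>0$, and let $N_w,N_b>0$, $\delta\in(0,1)$. Then the throughput pair $$r=\frac{N_w}{N_b}\sqrt{\frac{\delta W}{c_{\min}}},\qquad r_K=\Big(1-\frac{N_w}{N_b}\Big)^{+}\sqrt{\frac{\delta W}{c_{\min}}}$$ is achievable under the KL-divergence metric by the BPSK/RRC scheme: there are codes with decoders, one for each duration $T$, which for all sufficiently large $T$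 are BPSK/RRC codes with $\widehat E$ fitting into $\mathcal S_W$ and $\mathbb D(\widehat Q\,\|\,Q_0^{\otimes n})\le\delta$, such that $$\liminf_{T\to\infty}\frac{\log M}{\sqrt T}\ge r,\qquad \limsup_{T\to\infty}\frac{\log K}{\sqrt T}\le r_K,\qquad \lim_{T\to\infty}P_{\mathrm{err}}=0,$$ and $\lim_{T\to\infty}\mathbb D(\widehat Q\,\|\,Q_0^{\otimes n})$ exists (and is at most $\delta$). -/

import Mathlib

open MeasureTheory ProbabilityTheory Filter Topology FourierTransform
open scoped ENNReal NNReal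

noncomputable section

namespace Covert

/-- The (time-domain) root raised cosine pulse with pulse duration `T₀` and roll-off factor `β`;
it vanishes for `|t| > T₀ / 2`. -/
def rrc (T₀ β t : ℝ) : ℝ :=
  if |t| ≤ (1 - β) / (1 + β) * (T₀ / 2) then
    Real.sqrt ((1 + β) / T₀)
  else if |t| ≤ T₀ / 2 then
    Real.sqrt
      ((1 + Real.cos (Real.pi * (1 + β) / (T₀ * β) * (|t| - (1 - β) / (1 + β) * (T₀ / 2)))) /
        (2 * T₀ / (1 + β)))
  else 0

/-- The energy spectral density `|x̂(f)|²` of a real signal `x`,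
where `x̂(f) = ∫ x(t) exp(-2πi f t) dt`. -/
def esd (x : ℝ → ℝ) (f : ℝ) : ℝ :=
  ‖𝓕 (fun t : ℝ => (x t : ℂ)) f‖ ^ 2

/-- The parameters of a spectral mask: the bandwidth of interest `W`, and `l ≥ 1` constraints with
non-decreasing parameters `U i` (in dB), `α i` and `η i`. -/
structure SpectralMask where
  /-- number of constraints -/
  l : ℕ
  l_pos : 0 < l
  /-- bandwidth of interest -/
  W : ℝ
  W_pos : 0 < W
  /-- attenuation levels in dB -/
  U : Fin l → ℝ
  /-- relative bandwidths -/
  α : Fin l → ℝ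
  /-- energy fractions -/
  η : Fin l → ℝ
  U_mono : Monotone U
  α_mono : Monotone α
  η_mono : Monotone η

namespace SpectralMask

variable (S : SpectralMask)

/-- `V i = 10 ^ (-U i / 10)`. -/
def V (i : Fin S.l) : ℝ := (10 : ℝ) ^ (-(S.U i) / 10)

/-- An energy spectral density `E` fits into the spectral mask. -/
def Fits (E : ℝ → ℝ) : Prop :=
  ∀ i : Fin S.l,
    (∀ f : ℝ, S.α i * S.W ≤ f → E f < S.V i * ⨆ f' : ℝ, E f') ∧
    S.η i * (∫ f, E f) ≤ ∫ f in Set.Icc (-(S.α i * S.W)) (S.α i * S.W), E f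

/-- The pulse duration `T₀` is feasible for the roll-off factor `β`: a single pulse
meets the spectral constraints (the spectrum of the nonnegative pulse has its maximum at `0`, and
the pulse has unit energy). -/
def Feasible (β T₀ : ℝ) : Prop :=
  0 < T₀ ∧ ∀ i : Fin S.l,
    (∀ f : ℝ, S.α i * S.W ≤ f → esd (rrc T₀ β) f < S.V i * esd (rrc T₀ β) 0) ∧
    S.η i ≤ ∫ f in Set.Icc (-(S.α i * S.W)) (S.α i * S.W), esd (rrc T₀ β) f

/-- The optimal pulse duration for the roll-off factor `β`
(equal to `∞` if no pulse duration is feasible for this `β`). -/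
def optDuration (β : ℝ) : ℝ≥0∞ :=
  ⨅ T₀ ∈ {T₀ : ℝ | S.Feasible β T₀}, ENNReal.ofReal T₀

/-- The constant `c(β)`: the product of the bandwidth and the optimal pulse duration. -/
def c (β : ℝ) : ℝ≥0∞ := ENNReal.ofReal S.W * S.optDuration β

/-- The optimal value of `c(β)` over the roll-off factors `β ∈ [0,1]`. -/
def minC : ℝ≥0∞ := ⨅ β ∈ Set.Icc (0 : ℝ) 1, S.c β

end SpectralMask

/-- The index set of the linear functionals of white noise: real `L²` functions on the line. -/
abbrev L2 : Type := Lp ℝ 2 (volume : Measure ℝ)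

/-- `B` is white Gaussian noise with intensity `N / 2`, given through its linear functionals
`B g = ∫ B(t) g(t) dt`, `g ∈ L²`: these are jointly Gaussian and centered with covariance
`(N / 2) ∫ g h`. -/
structure IsWGN {Ω : Type*} [MeasurableSpace Ω] (P : Measure Ω) (B : L2 → Ω → ℝ) (N : ℝ) :
    Prop where
  measurable : ∀ g, Measurable (B g)
  gaussian : IsGaussianProcess B P
  mean : ∀ g, ∫ ω, B g ω ∂P = 0
  cov : ∀ g h, ∫ ω, B g ω * B h ω ∂P = N / 2 * ∫ t, g t * h t

/-- A pulse amplitude modulation code on `[0,T]`, with `n` orthonormal carriers supported in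
`[0,T]`, `M` messages, `K` keys, and a discrete-time codeword for each message-key pair. -/
structure PAMCode (T : ℝ) where
  /-- blocklength -/
  n : ℕ
  /-- number of messages -/
  M : ℕ
  /-- number of keys -/
  K : ℕ
  M_pos : 0 < M
  K_pos : 0 < K
  /-- carrier pulses -/
  carrier : Fin n → ℝ → ℝ
  carrier_memLp : ∀ i, MemLp (carrier i) 2 volume
  carrier_support : ∀ i t, t ∉ Set.Icc 0 T → carrier i t = 0
  carrier_orthonormal : ∀ i j, ∫ t, carrier i t * carrier j t = if i = j then 1 else 0
  /-- discrete-time codewords -/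
  x : Fin M → Fin K → Fin n → ℝ

namespace PAMCode

variable {T : ℝ} (C : PAMCode T)

/-- The continuous-time codeword of the message-key pair `(m,s)`. -/
def signal (m : Fin C.M) (s : Fin C.K) (t : ℝ) : ℝ := ∑ i, C.x m s i * C.carrier i t

/-- The energy spectral density of the code: the average over all codewords. -/
def codeESD (f : ℝ) : ℝ := (1 / ((C.M : ℝ) * C.K)) * ∑ m, ∑ s, esd (C.signal m s) f

/-- The scheme with BPSK and root raised cosine pulses: for a pulse duration `T₀` and a roll-off
factor `β`, the code uses the `⌊T / T₀⌋` consecutive translates of the pulse that fill `[0,T]`,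
and all discrete-time codewords have entries in `{-a, a}`. -/
def IsBPSKRRC : Prop :=
  ∃ T₀ β a : ℝ, 0 < T₀ ∧ β ∈ Set.Icc (0 : ℝ) 1 ∧ 0 < a ∧ C.n = ⌊T / T₀⌋₊ ∧
    (∀ i t, C.carrier i t = rrc T₀ β (t - ((i : ℝ) + 1 / 2) * T₀)) ∧
    ∀ m s i, C.x m s i = a ∨ C.x m s i = -a

/-- The distribution of the length-`n` output of the channel with independent
`N(0, N / 2)` noise on input `x`. -/
def outputDist {n : ℕ} (N : ℝ) (x : Fin n → ℝ) : Measure (Fin n → ℝ) :=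
  Measure.pi fun i => gaussianReal (x i) (N / 2).toNNReal

/-- The distribution of the warden's observation when the transmitter is active. -/
def activeDist (Nw : ℝ) : Measure (Fin C.n → ℝ) :=
  ((C.M : ℝ≥0∞) * C.K)⁻¹ • ∑ m, ∑ s, outputDist Nw (C.x m s)

/-- The distribution of the warden's observation when the transmitter is silent. -/
def silentDist (Nw : ℝ) : Measure (Fin C.n → ℝ) := outputDist Nw 0

/-- The covertness metric: the KL divergence of the active from the silent distribution. -/
def kl (Nw : ℝ) : ℝ≥0∞ := InformationTheory.klDiv (C.activeDist Nw) (C.silentDist Nw)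

/-- A decoder: for each key, a measurable function of the received signal, which is given by its
linear functionals `g ↦ ∫ Y(t) g(t) dt`. The output `0` stands for "no message" and
`m.succ` for the message `m`. -/
structure Decoder where
  /-- decoding functions -/
  toFun : Fin C.K → (L2 → ℝ) → Fin (C.M + 1)
  measurable : ∀ s, Measurable (toFun s)

/-- The received signal when the continuous-time signal `x` is sent. -/
def received {Ω : Type*} (B : L2 → Ω → ℝ) (x : ℝ → ℝ) (ω : Ω) : L2 → ℝ :=
  fun g => (∫ t, x t * g t) + B g ω

variable {C} in
/-- The max-average probability of error: maximum over the keys of the average over the messages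
of the error probability, plus the probability of decoding some message when the transmitter is
silent. -/
def Decoder.perr (Γ : C.Decoder) {Ω : Type*} [MeasurableSpace Ω] (P : Measure Ω)
    (B : L2 → Ω → ℝ) : ℝ :=
  (⨆ s : Fin C.K, (1 / (C.M : ℝ)) *
      ∑ m : Fin C.M, P.real {ω | Γ.toFun s (received B (C.signal m s) ω) ≠ m.succ}) +
    (1 / (C.K : ℝ)) * ∑ s : Fin C.K, P.real {ω | Γ.toFun s (received B 0 ω) ≠ 0}

end PAMCode

/-- The codes `C T` with decoders `Γ T`, for transmission durations `T → ∞`, achieve the throughput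
pair `(r, rK)` under the spectral mask `S` and the KL-divergence covertness metric, where
`B` is the noise at the receiver and `N_w / 2` is the intensity of the noise at the warden. -/
structure AchievesKL (S : SpectralMask) {Ω : Type*} [MeasurableSpace Ω] (P : Measure Ω)
    (B : L2 → Ω → ℝ) (Nw δ r rK : ℝ) (C : ∀ T : ℝ, PAMCode T) (Γ : ∀ T : ℝ, (C T).Decoder) :
    Prop where
  rate : (r : EReal) ≤
    liminf (fun T : ℝ => ((Real.log ((C T).M : ℝ) / Real.sqrt T : ℝ) : EReal)) atTop
  keyRate :
    limsup (fun T : ℝ => ((Real.log ((C T).K : ℝ) / Real.sqrt T : ℝ) : EReal)) atTop ≤ (rK : EReal)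
  reliable : Tendsto (fun T : ℝ => (Γ T).perr P B) atTop (𝓝 0)
  covert : ∀ᶠ T : ℝ in atTop, (C T).kl Nw ≤ ENNReal.ofReal δ
  covert_lim : ∃ L ≤ ENNReal.ofReal δ, Tendsto (fun T : ℝ => (C T).kl Nw) atTop (𝓝 L)
  mask : ∀ᶠ T : ℝ in atTop, S.Fits (C T).codeESD

end Covert

end

noncomputable section

namespace Covert

/-! ### Plancherel's theorem for integrable and square integrable functions -/

/-! The codes are random linear codes. The carriers are `n` adjacent translates of one feasible
pulse, and the codeword of `u = (m, s)`, a binary vector of length `k₁ + k₂`, has entries `a * chi u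
(g i)`, where the vectors `g i` are drawn uniformly. Linearity serves three purposes.

Spectrum. If the `g i` are distinct, orthogonality of characters makes the coordinates of a uniform
codeword uncorrelated. The code spectrum is then exactly `n a²` times that of one pulse
(`PAMCode.codeESD_of_white`), and the mask constraints reduce to feasibility of the pulse. Since a
collision has probability at most `n² / 2 ^ (k₁ + k₂)`, distinctness costs nothing.

Covertness. The mixture density is invariant under the sign patterns of the code, so the divergence
equals `n * bpskDiv` plus a nonnegative resolvability term (`klDiv_mixDist`,
`resolvability_nonneg`). With `v = Nw / 2` and `s = a² / v`, the first term is `n s² / 4 + O(n s³)`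
(`abs_bpskDiv_sub_le`). A soft-covering bound with exponent `ρ` makes the average of the second term
small once `log (M K)` exceeds `n s / 2 = n a² / Nw` by a fixed fraction (`sum_resolvability_le`).

Reliability. Correlating with the codewords and using Chernoff and union bounds gives vanishing
error when `log M` stays a fixed fraction below `n a² / Nb` (`perr_thresholdDecoder_le`,
`sum_correlationSum_le`). By linearity the bound is the same for all messages and keys.

The choice `n a² ≈ Nw √(δ n)` makes `n s² / 4 ≈ δ`, so `log M ≈ (Nw / Nb) √(δ n)` and `log (M K) ≈
max(1, Nw / Nb) √(δ n)` are possible. A first-moment argument yields one `g` with all three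
properties (`exists_signs`, `eventually_exists_signs`). With `n = ⌊T / T₀⌋` and `W T₀` close to
`c_min`, `√n / √T` tends to `1 / √T₀`, which is close to `√(W / c_min)`. A diagonal argument removes
the slack. -/

open scoped SchwartzMap ContDiff in
lemma ae_eq_fourier_toLp {f : ℝ → ℂ} (hf : Integrable f) (hf2 : MemLp f 2) :
    (𝓕 (hf2.toLp f) : Lp ℂ 2 (volume : Measure ℝ)) =ᵐ[volume] 𝓕 f := by
  have hcont : Continuous (𝓕 f) :=
    VectorFourier.fourierIntegral_continuous Real.continuous_fourierChar (by fun_prop) hf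
  -- Both sides are locally integrable, so testing against smooth compactly supported functions
  -- suffices. There the `L²` transform acts by distributional duality and the integral transform by
  -- Fubini; both move `𝓕` onto the test function.
  refine ae_eq_of_integral_contDiff_smul_eq
    ((Lp.memLp _).locallyIntegrable (by norm_num)) hcont.locallyIntegrable fun g hg hgc => ?_
  have hg₁ : HasCompactSupport (Complex.ofRealCLM ∘ g) := hgc.comp_left rfl
  have hg₂ : ContDiff ℝ ∞ (Complex.ofRealCLM ∘ g) := by fun_prop
  set ψ : 𝓢(ℝ, ℂ) := hg₁.toSchwartzMap hg₂ with hψ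
  have h1 := DFunLike.congr_fun (Lp.fourier_toTemperedDistribution_eq (hf2.toLp f)) ψ
  rw [TemperedDistribution.fourier_apply, Lp.toTemperedDistribution_apply,
    Lp.toTemperedDistribution_apply] at h1
  have h2 : ∫ x, g x • (𝓕 (hf2.toLp f) : Lp ℂ 2 (volume : Measure ℝ)) x =
      ∫ x, ψ x • (𝓕 (hf2.toLp f) : Lp ℂ 2 (volume : Measure ℝ)) x := by
    refine integral_congr_ae (.of_forall fun x => ?_)
    simp [hψ]
  have h3 : ∫ x, (𝓕 ψ) x • (hf2.toLp f) x = ∫ x, (𝓕 ψ) x • f x :=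
    integral_congr_ae (hf2.coeFn_toLp.mono fun x hx => by simp only [hx])
  have h4 := VectorFourier.integral_fourierIntegral_smul_eq_flip (e := Real.fourierChar)
    (L := innerₗ ℝ) (μ := volume) (ν := volume) (f := ψ) (g := f) Real.continuous_fourierChar
    (by fun_prop) ψ.integrable hf
  rw [h2, ← h1, h3, SchwartzMap.fourier_coe]
  refine h4.trans (integral_congr_ae (.of_forall fun x => ?_))
  simp only [flip_innerₗ]
  simp [hψ, Real.fourier_eq, VectorFourier.fourierIntegral]

lemma integral_norm_sq_eq_norm_Lp (f : Lp ℂ 2 (volume : Measure ℝ)) :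
    ∫ x, ‖f x‖ ^ 2 = ‖f‖ ^ 2 := by
  have h := L2.inner_def (𝕜 := ℂ) f f
  rw [inner_self_eq_norm_sq_to_K] at h
  have h2 : ∀ x, inner ℂ (f x) (f x) = ((‖f x‖ ^ 2 : ℝ) : ℂ) := fun x => by
    rw [inner_self_eq_norm_sq_to_K]; push_cast; rfl
  simp_rw [h2, integral_complex_ofReal] at h
  exact Complex.ofReal_injective (h.symm.trans (by push_cast; rfl))

lemma integral_norm_sq_fourier {f : ℝ → ℂ} (hf : Integrable f) (hf2 : MemLp f 2) :
    ∫ w, ‖𝓕 f w‖ ^ 2 = ∫ t, ‖f t‖ ^ 2 := by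
  calc ∫ w, ‖𝓕 f w‖ ^ 2 = ∫ w, ‖(𝓕 (hf2.toLp f) : Lp ℂ 2 (volume : Measure ℝ)) w‖ ^ 2 :=
        integral_congr_ae ((ae_eq_fourier_toLp hf hf2).mono fun x hx => by simp only [hx])
    _ = ∫ t, ‖hf2.toLp f t‖ ^ 2 := by
        rw [integral_norm_sq_eq_norm_Lp, integral_norm_sq_eq_norm_Lp, Lp.norm_fourier_eq]
    _ = _ := integral_congr_ae (hf2.coeFn_toLp.mono fun x hx => by simp only [hx])

/-! ### The root raised cosine pulse -/

section Pulse

variable {T₀ β : ℝ}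

lemma rrc_nonneg (t : ℝ) : 0 ≤ rrc T₀ β t := by
  unfold rrc; split_ifs <;> positivity

lemma measurable_rrc : Measurable (rrc T₀ β) := by
  unfold rrc
  refine Measurable.ite (measurableSet_le (by fun_prop) (by fun_prop)) (by fun_prop) ?_
  exact Measurable.ite (measurableSet_le (by fun_prop) (by fun_prop)) (by fun_prop) (by fun_prop)

lemma ratio_le_one (hβ : β ∈ Set.Icc (0 : ℝ) 1) : (1 - β) / (1 + β) ≤ 1 := by
  have := hβ.1
  rw [div_le_one (by linarith)]; linarith

lemma ratio_nonneg (hβ : β ∈ Set.Icc (0 : ℝ) 1) : 0 ≤ (1 - β) / (1 + β) :=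
  div_nonneg (by linarith [hβ.2]) (by linarith [hβ.1])

lemma rrc_eq_zero (hT : 0 < T₀) (hβ : β ∈ Set.Icc (0 : ℝ) 1) {t : ℝ} (ht : T₀ / 2 < |t|) :
    rrc T₀ β t = 0 := by
  have := mul_le_mul_of_nonneg_right (ratio_le_one hβ) (by positivity : 0 ≤ T₀ / 2)
  unfold rrc
  rw [if_neg (by linarith), if_neg (by linarith)]

lemma rrc_le (hT : 0 < T₀) (hβ : β ∈ Set.Icc (0 : ℝ) 1) (t : ℝ) :
    rrc T₀ β t ≤ Real.sqrt ((1 + β) / T₀) := by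
  have h1 := hβ.1
  unfold rrc; split_ifs
  · exact le_rfl
  · refine Real.sqrt_le_sqrt ?_
    rw [div_le_div_iff₀ (by positivity) hT]
    have := Real.cos_le_one (Real.pi * (1 + β) / (T₀ * β) * (|t| - (1 - β) / (1 + β) * (T₀ / 2)))
    have h2 : (1 + β) * (2 * T₀ / (1 + β)) = 2 * T₀ := by field_simp
    rw [h2]; nlinarith
  · positivity

lemma rrc_memLp (hT : 0 < T₀) (hβ : β ∈ Set.Icc (0 : ℝ) 1) (p : ℝ≥0∞) :
    MemLp (rrc T₀ β) p volume := by
  have h : rrc T₀ β = Set.indicator (Set.Icc (-(T₀ / 2)) (T₀ / 2)) (rrc T₀ β) := by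
    ext t
    by_cases ht : t ∈ Set.Icc (-(T₀ / 2)) (T₀ / 2)
    · rw [Set.indicator_of_mem ht]
    · rw [Set.indicator_of_notMem ht, rrc_eq_zero hT hβ]
      by_contra! h
      exact ht (abs_le.mp h)
  rw [h, memLp_indicator_iff_restrict measurableSet_Icc]
  exact MemLp.of_bound measurable_rrc.aestronglyMeasurable _ (.of_forall fun t => by
    rw [Real.norm_of_nonneg (rrc_nonneg t)]; exact rrc_le hT hβ t)

lemma rrc_integrable (hT : 0 < T₀) (hβ : β ∈ Set.Icc (0 : ℝ) 1) : Integrable (rrc T₀ β) :=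
  memLp_one_iff_integrable.mp (rrc_memLp hT hβ 1)

lemma integral_rrc_sq (hT : 0 < T₀) (hβ : β ∈ Set.Icc (0 : ℝ) 1) :
    ∫ t, rrc T₀ β t ^ 2 = 1 := by
  have hβ1 : 0 < 1 + β := by linarith [hβ.1]
  set A := (1 - β) / (1 + β) * (T₀ / 2) with hA
  have hA0 : 0 ≤ A := mul_nonneg (ratio_nonneg hβ) (by positivity)
  have hAT : A ≤ T₀ / 2 := by
    have := mul_le_mul_of_nonneg_right (ratio_le_one hβ) (by positivity : 0 ≤ T₀ / 2)
    linarith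
  have habs : ∀ t, rrc T₀ β t ^ 2 = (fun x => rrc T₀ β x ^ 2) |t| := by
    intro t; simp [rrc]
  rw [integral_congr_ae (.of_forall habs), integral_comp_abs (f := fun x => rrc T₀ β x ^ 2)]
  have hint : Integrable (fun x => rrc T₀ β x ^ 2) := (rrc_memLp hT hβ 2).integrable_sq
  have hs : Set.Ioi (0 : ℝ) = Set.Ioc 0 A ∪ Set.Ioc A (T₀ / 2) ∪ Set.Ioi (T₀ / 2) := by
    rw [Set.Ioc_union_Ioc_eq_Ioc hA0 hAT, Set.Ioc_union_Ioi_eq_Ioi (by linarith)]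
  rw [hs, setIntegral_union _ measurableSet_Ioi hint.integrableOn hint.integrableOn,
    setIntegral_union _ measurableSet_Ioc hint.integrableOn hint.integrableOn]
  rotate_left
  · exact Set.disjoint_left.mpr fun x hx hx' => absurd hx.2 (not_le.mpr hx'.1)
  · rw [Set.Ioc_union_Ioc_eq_Ioc hA0 hAT]
    exact Set.disjoint_left.mpr fun x hx hx' => absurd hx.2 (not_le.mpr hx')
  have e1 : ∫ t in Set.Ioc 0 A, rrc T₀ β t ^ 2 = A * ((1 + β) / T₀) := by
    rw [setIntegral_congr_fun (g := fun _ => (1 + β) / T₀) measurableSet_Ioc]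
    · simp [hA0]
    · intro t ht
      simp only
      rw [rrc, if_pos (by rw [abs_of_pos ht.1]; exact ht.2), Real.sq_sqrt (by positivity)]
  have e3 : ∫ t in Set.Ioi (T₀ / 2), rrc T₀ β t ^ 2 = 0 := by
    refine setIntegral_eq_zero_of_forall_eq_zero fun t ht => ?_
    rw [rrc_eq_zero hT hβ (lt_of_lt_of_le ht (le_abs_self t))]; simp
  have e2 : ∫ t in Set.Ioc A (T₀ / 2), rrc T₀ β t ^ 2 = (T₀ / 2 - A) * ((1 + β) / (2 * T₀)) := by
    set ω := Real.pi * (1 + β) / (T₀ * β) with hω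
    have : ∀ t ∈ Set.Ioc A (T₀ / 2),
        rrc T₀ β t ^ 2 = (1 + Real.cos (ω * (t - A))) * ((1 + β) / (2 * T₀)) := by
      intro t ht
      have ht0 : 0 < t := lt_of_le_of_lt hA0 ht.1
      have hc := Real.neg_one_le_cos (ω * (t - A))
      rw [rrc, abs_of_pos ht0, if_neg (not_le.mpr ht.1), if_pos ht.2, Real.sq_sqrt]
      · rw [← hA, ← hω]; field_simp
      · exact div_nonneg (by linarith) (by positivity)
    rw [setIntegral_congr_fun measurableSet_Ioc this, ← intervalIntegral.integral_of_le hAT,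
      intervalIntegral.integral_mul_const]
    congr 1
    -- For `β = 0` the frequency `ω` is a division by zero, but the roll-off interval is empty.
    rcases hβ.1.eq_or_lt with h0 | h0
    · have : A = T₀ / 2 := by rw [hA, ← h0]; simp
      rw [this]; simp
    have hω0 : ω ≠ 0 := by rw [hω]; have := Real.pi_pos; positivity
    rw [intervalIntegral.integral_add (by simp) (by
      apply Continuous.intervalIntegrable; fun_prop)]
    have : ∫ t in A..(T₀ / 2), Real.cos (ω * (t - A)) = 0 := by
      -- The roll-off spans exactly half a period of the cosine, so the cosine integrates to zero.
      have hpi : ω * (T₀ / 2 - A) = Real.pi := by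
        rw [hω, hA]; field_simp; ring
      have hd : ∀ t ∈ Set.uIcc A (T₀ / 2),
          HasDerivAt (fun t => Real.sin (ω * (t - A)) / ω) (Real.cos (ω * (t - A))) t := by
        intro t _
        have h1 : HasDerivAt (fun t => ω * (t - A)) ω t := by
          simpa using ((hasDerivAt_id t).sub_const A).const_mul ω
        have h2 := (h1.sin).div_const ω
        rwa [mul_div_cancel_right₀ _ hω0] at h2
      rw [intervalIntegral.integral_eq_sub_of_hasDerivAt hd
        (by apply Continuous.intervalIntegrable; fun_prop), hpi]
      simp
    rw [this]; simp
  rw [e1, e2, e3, hA]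
  field_simp; ring

end Pulse

/-! ### Translates of the pulse and the spectrum of a white code -/

section Pulse

variable {T₀ β : ℝ}

lemma rrc_shift_memLp (hT : 0 < T₀) (hβ : β ∈ Set.Icc (0 : ℝ) 1) (p : ℝ≥0∞) (c : ℝ) :
    MemLp (fun t => rrc T₀ β (t - c)) p volume :=
  (rrc_memLp hT hβ p).comp_measurePreserving (measurePreserving_sub_right volume c)

lemma integral_rrc_shift_mul_eq_zero (hT : 0 < T₀) (hβ : β ∈ Set.Icc (0 : ℝ) 1) {c d : ℝ}
    (h : c + T₀ ≤ d) : ∫ t, rrc T₀ β (t - c) * rrc T₀ β (t - d) = 0 := by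
  refine integral_eq_zero_of_ae ?_
  -- The closed supports of adjacent pulses may share this one endpoint.
  have : ∀ᵐ t : ℝ, t ≠ (c + T₀ / 2) := by
    simp [ae_iff]
  filter_upwards [this] with t ht
  simp only [Pi.zero_apply, mul_eq_zero]
  by_contra! hne
  have h1 : |t - c| ≤ T₀ / 2 := by
    by_contra! hh; exact hne.1 (rrc_eq_zero hT hβ hh)
  have h2 : |t - d| ≤ T₀ / 2 := by
    by_contra! hh; exact hne.2 (rrc_eq_zero hT hβ hh)
  rw [abs_le] at h1 h2
  exact ht (by linarith)

lemma rrc_shift_orthonormal (hT : 0 < T₀) (hβ : β ∈ Set.Icc (0 : ℝ) 1) (i j : ℕ) :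
    ∫ t, rrc T₀ β (t - ((i : ℝ) + 1 / 2) * T₀) * rrc T₀ β (t - ((j : ℝ) + 1 / 2) * T₀) =
      if i = j then 1 else 0 := by
  have key : ∀ i j : ℕ, i < j → ((i : ℝ) + 1 / 2) * T₀ + T₀ ≤ ((j : ℝ) + 1 / 2) * T₀ := by
    intro i j hij
    have : (i : ℝ) + 1 ≤ j := by exact_mod_cast hij
    nlinarith
  split_ifs with h
  · subst h
    simp_rw [← sq]
    rw [integral_sub_right_eq_self (fun t => rrc T₀ β t ^ 2), integral_rrc_sq hT hβ]
  · rcases lt_or_gt_of_ne h with h | h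
    · exact integral_rrc_shift_mul_eq_zero hT hβ (key i j h)
    · simp_rw [mul_comm (rrc T₀ β (_ - ((i : ℝ) + 1 / 2) * T₀))]
      exact integral_rrc_shift_mul_eq_zero hT hβ (key j i h)

lemma fourier_shift (φ : ℝ → ℂ) (c f : ℝ) :
    𝓕 (fun t => φ (t - c)) f = (Real.fourierChar (-(c * f)) : ℂ) * 𝓕 φ f := by
  have h := congrFun (Fourier.fourierIntegral_comp_add_right Real.fourierChar volume φ (-c)) f
  simp only [neg_mul, Circle.smul_def, smul_eq_mul, Fourier.fourierIntegral_def,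
    Function.comp_def, ← sub_eq_add_neg] at h
  simpa only [Real.fourier_real_eq, Circle.smul_def, smul_eq_mul] using h

lemma fourier_sum_shift (hT : 0 < T₀) (hβ : β ∈ Set.Icc (0 : ℝ) 1) {n : ℕ} (x c : Fin n → ℝ)
    (f : ℝ) :
    𝓕 (fun t : ℝ => ((∑ i, x i * rrc T₀ β (t - c i) : ℝ) : ℂ)) f =
      (∑ i, (x i : ℂ) * (Real.fourierChar (-(c i * f)) : ℂ)) *
        𝓕 (fun t : ℝ => (rrc T₀ β t : ℂ)) f := by
  have hint : ∀ i, Integrable (fun t : ℝ => (rrc T₀ β (t - c i) : ℂ)) := fun i =>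
    ((rrc_integrable hT hβ).comp_sub_right (c i)).ofReal
  have h1 : ∀ i, 𝓕 (fun t : ℝ => (rrc T₀ β (t - c i) : ℂ)) f =
      (Real.fourierChar (-(c i * f)) : ℂ) * 𝓕 (fun t : ℝ => (rrc T₀ β t : ℂ)) f :=
    fun i => fourier_shift (fun t => (rrc T₀ β t : ℂ)) (c i) f
  rw [Finset.sum_mul]
  simp_rw [mul_assoc, ← h1]
  simp only [Real.fourier_real_eq, Circle.smul_def, smul_eq_mul]
  simp_rw [← integral_const_mul]
  rw [← integral_finsetSum]
  · congr 1; ext t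
    push_cast
    rw [Finset.mul_sum]
    exact Finset.sum_congr rfl fun i _ => by ring
  · intro i _
    refine Integrable.const_mul ?_ _
    have := (Real.fourierIntegral_convergent_iff (μ := volume) f).mpr (hint i)
    simpa [Circle.smul_def, mul_comm] using this

lemma norm_sq_sum_mul {n : ℕ} (x : Fin n → ℝ) (z : Fin n → ℂ) :
    ‖∑ i, (x i : ℂ) * z i‖ ^ 2 = ∑ i, ∑ j, x i * x j * (z i * (starRingEnd ℂ) (z j)).re := by
  have h : ((‖∑ i, (x i : ℂ) * z i‖ ^ 2 : ℝ) : ℂ) =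
      ∑ i, ∑ j, (x i * x j : ℂ) * (z i * (starRingEnd ℂ) (z j)) := by
    push_cast
    rw [← Complex.mul_conj', map_sum, Finset.sum_mul_sum]
    refine Finset.sum_congr rfl fun i _ => Finset.sum_congr rfl fun j _ => ?_
    rw [map_mul, Complex.conj_ofReal]; ring
  have h2 := congrArg Complex.re h
  rw [Complex.ofReal_re] at h2
  rw [h2, Complex.re_sum]
  refine Finset.sum_congr rfl fun i _ => ?_
  rw [Complex.re_sum]
  refine Finset.sum_congr rfl fun j _ => ?_
  rw [← Complex.ofReal_mul, Complex.re_ofReal_mul]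

/-- The pulse is nonnegative, so its transform is bounded by its integral, which is the value at
`0`. This identifies the supremum in `SpectralMask.Fits`. -/
lemma esd_rrc_le (f : ℝ) :
    esd (rrc T₀ β) f ≤ esd (rrc T₀ β) 0 := by
  have h0 : ‖𝓕 (fun t : ℝ => (rrc T₀ β t : ℂ)) 0‖ = ∫ t, rrc T₀ β t := by
    have : 𝓕 (fun t : ℝ => (rrc T₀ β t : ℂ)) 0 = ((∫ t, rrc T₀ β t : ℝ) : ℂ) := by
      rw [Real.fourier_real_eq, ← integral_complex_ofReal]
      simp
    rw [this, Complex.norm_real, Real.norm_of_nonneg (integral_nonneg rrc_nonneg)]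
  have h1 : ‖𝓕 (fun t : ℝ => (rrc T₀ β t : ℂ)) f‖ ≤ ∫ t, rrc T₀ β t := by
    refine (VectorFourier.norm_fourierIntegral_le_integral_norm _ _ _ _ _).trans (le_of_eq ?_)
    refine integral_congr_ae (.of_forall fun t => ?_)
    simp [abs_of_nonneg (rrc_nonneg t)]
  unfold esd
  rw [h0]
  gcongr

lemma integral_esd_rrc (hT : 0 < T₀) (hβ : β ∈ Set.Icc (0 : ℝ) 1) :
    ∫ f, esd (rrc T₀ β) f = 1 := by
  have h1 : Integrable (fun t : ℝ => (rrc T₀ β t : ℂ)) := (rrc_integrable hT hβ).ofReal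
  have h2 : MemLp (fun t : ℝ => (rrc T₀ β t : ℂ)) 2 := (rrc_memLp hT hβ 2).ofReal
  unfold esd
  rw [integral_norm_sq_fourier h1 h2]
  simp [← integral_rrc_sq hT hβ]

lemma SpectralMask.Feasible.fits_const_mul {S : SpectralMask} (hβ : β ∈ Set.Icc (0 : ℝ) 1)
    (h : S.Feasible β T₀) {A : ℝ} (hA : 0 < A) :
    S.Fits (fun f => A * esd (rrc T₀ β) f) := by
  obtain ⟨hT, h⟩ := h
  have hsup : ⨆ f' : ℝ, A * esd (rrc T₀ β) f' = A * esd (rrc T₀ β) 0 := by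
    refine ciSup_eq_of_forall_le_of_forall_lt_exists_gt ?_ fun w hw => ⟨0, hw⟩
    exact fun f => mul_le_mul_of_nonneg_left (esd_rrc_le f) hA.le
  intro i
  refine ⟨fun f hf => ?_, ?_⟩
  · rw [hsup]
    have := mul_lt_mul_of_pos_left ((h i).1 f hf) hA
    linarith
  · rw [integral_const_mul, integral_const_mul, integral_esd_rrc hT hβ]
    have := mul_le_mul_of_nonneg_left (h i).2 hA.le
    linarith

/-- A translate contributes only a phase to the transform. In the averaged squared modulus the cross
terms cancel by `hx`, and the diagonal phases have modulus one. -/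
lemma PAMCode.codeESD_of_white {T : ℝ} (C : PAMCode T) (hT : 0 < T₀)
    (hβ : β ∈ Set.Icc (0 : ℝ) 1) {a : ℝ}
    (hc : ∀ i t, C.carrier i t = rrc T₀ β (t - ((i : ℝ) + 1 / 2) * T₀))
    (hx : ∀ i j, ∑ m, ∑ s, C.x m s i * C.x m s j =
      if i = j then (C.M : ℝ) * C.K * a ^ 2 else 0) (f : ℝ) :
    C.codeESD f = C.n * a ^ 2 * esd (rrc T₀ β) f := by
  set z : Fin C.n → ℂ := fun i => (Real.fourierChar (-((((i : ℕ) : ℝ) + 1 / 2) * T₀ * f)) : ℂ)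
    with hz
  have h1 : ∀ m s, esd (C.signal m s) f =
      (∑ i, ∑ j, C.x m s i * C.x m s j * (z i * (starRingEnd ℂ) (z j)).re) *
        esd (rrc T₀ β) f := by
    intro m s
    have : C.signal m s = fun t => ∑ i, C.x m s i * rrc T₀ β (t - (((i : ℕ) : ℝ) + 1 / 2) * T₀) := by
      ext t; simp [PAMCode.signal, hc]
    rw [this]
    unfold esd
    rw [fourier_sum_shift hT hβ, norm_mul, mul_pow, norm_sq_sum_mul]
  have h2 : ∑ m, ∑ s, ∑ i, ∑ j, C.x m s i * C.x m s j * (z i * (starRingEnd ℂ) (z j)).re =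
      (C.M : ℝ) * C.K * (C.n * a ^ 2) := by
    calc _ = ∑ i, ∑ j, (∑ m, ∑ s, C.x m s i * C.x m s j) * (z i * (starRingEnd ℂ) (z j)).re := by
          simp_rw [Finset.sum_mul]
          rw [Finset.sum_congr rfl fun m _ => Finset.sum_comm, Finset.sum_comm]
          refine Finset.sum_congr rfl fun i _ => ?_
          rw [Finset.sum_congr rfl fun m _ => Finset.sum_comm, Finset.sum_comm]
      _ = ∑ i : Fin C.n, (C.M : ℝ) * C.K * a ^ 2 := by
          refine Finset.sum_congr rfl fun i _ => ?_
          simp only [hx, ite_mul, zero_mul, Finset.sum_ite_eq, Finset.mem_univ, if_true]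
          have h3 : ‖z i‖ = 1 := Circle.norm_coe _
          rw [Complex.mul_conj', h3]
          simp
      _ = _ := by simp; ring
  have hM : (C.M : ℝ) ≠ 0 := by exact_mod_cast C.M_pos.ne'
  have hK : (C.K : ℝ) ≠ 0 := by exact_mod_cast C.K_pos.ne'
  unfold PAMCode.codeESD
  simp_rw [h1, ← Finset.sum_mul]
  rw [h2]
  field_simp

end Pulse

/-! ### One-dimensional Gaussian estimates -/

/-- This is the second Taylor polynomial of `log` at `1`, and `log_le_cubic` has the third. They are
expanded in powers of `c` so that `c = cosh x` turns them into sums of exponentials with explicit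
Gaussian means. -/
lemma sub_sq_le_log {c : ℝ} (hc : 1 ≤ c) : -c ^ 2 / 2 + 2 * c - 3 / 2 ≤ Real.log c := by
  have hmono : MonotoneOn (fun c : ℝ => Real.log c - (-c ^ 2 / 2 + 2 * c - 3 / 2))
      (Set.Ici 1) := by
    refine monotoneOn_of_hasDerivWithinAt_nonneg (f' := fun x => x⁻¹ - (-x + 2)) (convex_Ici 1)
      ?_ ?_ ?_
    · refine ContinuousOn.sub (Real.continuousOn_log.mono ?_) (by fun_prop)
      intro x hx; exact (lt_of_lt_of_le one_pos hx).ne'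
    · intro x hx
      rw [interior_Ici] at hx
      have hx0 : (0 : ℝ) < x := lt_trans one_pos hx
      refine HasDerivAt.hasDerivWithinAt ?_
      refine (Real.hasDerivAt_log hx0.ne').sub ?_
      have h1 := (((hasDerivAt_pow 2 x).neg.div_const 2).add
        ((hasDerivAt_id x).const_mul 2)).sub_const (3 / 2)
      refine h1.congr_deriv ?_
      simp; ring
    · intro x hx
      rw [interior_Ici] at hx
      have hx0 : (0 : ℝ) < x := lt_trans one_pos hx
      have : x⁻¹ - (-x + 2) = (x - 1) ^ 2 / x := by field_simp; ring
      rw [this]; positivity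
  have := hmono (Set.mem_Ici.mpr le_rfl) (Set.mem_Ici.mpr hc) hc
  norm_num at this
  linarith

lemma log_le_cubic {c : ℝ} (hc : 1 ≤ c) :
    Real.log c ≤ c ^ 3 / 3 - 3 * c ^ 2 / 2 + 3 * c - 11 / 6 := by
  have hmono : MonotoneOn (fun c : ℝ => (c ^ 3 / 3 - 3 * c ^ 2 / 2 + 3 * c - 11 / 6) - Real.log c)
      (Set.Ici 1) := by
    refine monotoneOn_of_hasDerivWithinAt_nonneg (f' := fun x => (x ^ 2 - 3 * x + 3) - x⁻¹)
      (convex_Ici 1) ?_ ?_ ?_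
    · refine ContinuousOn.sub (by fun_prop) (Real.continuousOn_log.mono ?_)
      intro x hx; exact (lt_of_lt_of_le one_pos hx).ne'
    · intro x hx
      rw [interior_Ici] at hx
      have hx0 : (0 : ℝ) < x := lt_trans one_pos hx
      refine HasDerivAt.hasDerivWithinAt ?_
      refine HasDerivAt.sub ?_ (Real.hasDerivAt_log hx0.ne')
      have h1 := ((((hasDerivAt_pow 3 x).div_const 3).sub
        (((hasDerivAt_pow 2 x).const_mul 3).div_const 2)).add
        ((hasDerivAt_id x).const_mul 3)).sub_const (11 / 6)
      refine h1.congr_deriv ?_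
      simp; ring
    · intro x hx
      rw [interior_Ici] at hx
      have hx1 : (1 : ℝ) < x := hx
      have hx0 : (0 : ℝ) < x := lt_trans one_pos hx
      have : (x ^ 2 - 3 * x + 3) - x⁻¹ = (x - 1) ^ 3 / x := by field_simp; ring
      rw [this]
      exact div_nonneg (pow_nonneg (by linarith) 3) hx0.le
  have := hmono (Set.mem_Ici.mpr le_rfl) (Set.mem_Ici.mpr hc) hc
  norm_num at this
  linarith

lemma abs_exp_sub_quadratic_le {x : ℝ} (hx : |x| ≤ 1) :
    |Real.exp x - (1 + x + x ^ 2 / 2)| ≤ |x| ^ 3 := by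
  have h := Real.exp_bound hx (n := 3) (by norm_num)
  simp only [Finset.sum_range_succ, Finset.sum_range_zero, Nat.factorial] at h
  norm_num at h
  refine h.trans ?_
  have : 0 ≤ |x| ^ 3 := by positivity
  linarith

section Gaussian

variable {a : ℝ} {v : ℝ≥0}

lemma integral_exp_mul_gaussianReal (hv : v ≠ 0) (b : ℝ) :
    ∫ y, Real.exp (b * (a / v * y)) ∂gaussianReal a v =
      Real.exp ((b + b ^ 2 / 2) * (a ^ 2 / v)) := by
  have h := congrFun (mgf_fun_id_gaussianReal (μ := a) (v := v)) (b * (a / v))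
  have hv' : (v : ℝ) ≠ 0 := by exact_mod_cast hv
  simp only [mgf] at h
  simp_rw [← mul_assoc]
  rw [h]
  congr 1
  field_simp

lemma integrable_exp_mul_gaussianReal' (b : ℝ) :
    Integrable (fun y => Real.exp (b * (a / v * y))) (gaussianReal a v) := by
  have := integrable_exp_mul_gaussianReal (μ := a) (v := v) (b * (a / v))
  simpa only [mul_assoc] using this

lemma cosh_sq_eq (x : ℝ) : Real.cosh x ^ 2 = 1 / 2 + Real.exp (2 * x) / 4 + Real.exp (-2 * x) / 4 := by
  rw [Real.cosh_eq, show 2 * x = x + x by ring, show -2 * x = -x + -x by ring, Real.exp_add,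
    Real.exp_add, Real.exp_neg]
  field_simp; ring

lemma cosh_cube_eq (x : ℝ) : Real.cosh x ^ 3 =
    Real.exp (3 * x) / 8 + Real.exp (-3 * x) / 8 + 3 * Real.exp (1 * x) / 8 +
      3 * Real.exp (-1 * x) / 8 := by
  rw [Real.cosh_eq, show 3 * x = x + x + x by ring, show -3 * x = -x + -x + -x by ring, one_mul,
    neg_one_mul]
  simp only [Real.exp_add, Real.exp_neg]
  field_simp; ring

lemma cosh_eq' (x : ℝ) : Real.cosh x = Real.exp (1 * x) / 2 + Real.exp (-1 * x) / 2 := by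
  rw [Real.cosh_eq, one_mul, neg_one_mul]; ring

lemma log_cosh_nonneg (x : ℝ) : 0 ≤ Real.log (Real.cosh x) := Real.log_nonneg (Real.one_le_cosh x)

lemma integrable_sum_exp {k : ℕ} (c b : Fin k → ℝ) :
    Integrable (fun y => ∑ j, c j * Real.exp (b j * (a / v * y))) (gaussianReal a v) :=
  integrable_finsetSum _ fun _ _ => (integrable_exp_mul_gaussianReal' _).const_mul _

lemma integral_sum_exp (hv : v ≠ 0) {k : ℕ} (c b : Fin k → ℝ) :
    ∫ y, ∑ j, c j * Real.exp (b j * (a / v * y)) ∂gaussianReal a v =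
      ∑ j, c j * Real.exp ((b j + b j ^ 2 / 2) * (a ^ 2 / v)) := by
  rw [integral_finsetSum _ fun _ _ => (integrable_exp_mul_gaussianReal' _).const_mul _]
  simp_rw [integral_const_mul, integral_exp_mul_gaussianReal hv]

lemma continuous_log_cosh (t : ℝ) : Continuous fun y => Real.log (Real.cosh (t * y)) :=
  Continuous.log (by fun_prop) fun y => (Real.cosh_pos _).ne'

lemma integrable_log_cosh : Integrable (fun y => Real.log (Real.cosh (a / v * y)))
    (gaussianReal a v) := by
  refine Integrable.mono' (integrable_sum_exp (a := a) (v := v) ![1 / 2, 1 / 2] ![1, -1])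
    (continuous_log_cosh _).aestronglyMeasurable (.of_forall fun y => ?_)
  rw [Real.norm_of_nonneg (log_cosh_nonneg _)]
  refine (Real.log_le_sub_one_of_pos (Real.cosh_pos _)).trans ?_
  rw [cosh_eq']
  simp [Fin.sum_univ_succ]
  linarith

/-- The divergence of the equiprobable mixture of `N(a,v)` and `N(-a,v)` from `N(0,v)`. -/
def bpskDiv (a : ℝ) (v : ℝ≥0) : ℝ :=
  ∫ y, Real.log (Real.cosh (a / v * y)) ∂gaussianReal a v - a ^ 2 / v / 2

/-- The Taylor bounds squeeze `log cosh` between sums of exponentials. Expanding their means in `s =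
a² / v`, the linear term `s / 2` cancels the one subtracted in `bpskDiv`, and both bounds have the
same quadratic term. -/
lemma abs_bpskDiv_sub_le (hv : v ≠ 0) (hs : a ^ 2 / v ≤ 1 / 8) :
    |bpskDiv a v - (a ^ 2 / v) ^ 2 / 4| ≤ 200 * (a ^ 2 / v) ^ 3 := by
  have hlo : ∫ y, ∑ j, ![-1 / 8, -1 / 8, 1, 1, -7 / 4] j *
      Real.exp (![2, -2, 1, -1, 0] j * (a / v * y)) ∂gaussianReal a v ≤
      ∫ y, Real.log (Real.cosh (a / v * y)) ∂gaussianReal a v := by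
    refine integral_mono (integrable_sum_exp _ _) integrable_log_cosh fun y => ?_
    have := sub_sq_le_log (Real.one_le_cosh (a / v * y))
    rw [cosh_sq_eq, cosh_eq'] at this
    rw [cosh_eq']
    simp [Fin.sum_univ_succ] at this ⊢
    linarith
  have hup : ∫ y, Real.log (Real.cosh (a / v * y)) ∂gaussianReal a v ≤
      ∫ y, ∑ j, ![1 / 24, 1 / 24, -3 / 8, -3 / 8, 13 / 8, 13 / 8, -31 / 12] j *
        Real.exp (![3, -3, 2, -2, 1, -1, 0] j * (a / v * y)) ∂gaussianReal a v := by
    refine integral_mono integrable_log_cosh (integrable_sum_exp _ _) fun y => ?_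
    have := log_le_cubic (Real.one_le_cosh (a / v * y))
    rw [cosh_sq_eq, cosh_cube_eq, cosh_eq'] at this
    rw [cosh_eq']
    simp [Fin.sum_univ_succ] at this ⊢
    linarith
  rw [integral_sum_exp hv] at hlo hup
  unfold bpskDiv
  set I := ∫ y, Real.log (Real.cosh (a / v * y)) ∂gaussianReal a v
  set s : ℝ := a ^ 2 / v with hs_def
  have hs0 : 0 ≤ s := by positivity
  have key : ∀ b : ℝ, |b| ≤ 8 → |Real.exp (b * s) - (1 + b * s + (b * s) ^ 2 / 2)| ≤
      |b| ^ 3 * s ^ 3 := by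
    intro b hb
    have h := abs_exp_sub_quadratic_le (x := b * s) (by
      rw [abs_mul, abs_of_nonneg hs0]; nlinarith [abs_nonneg b])
    rwa [abs_mul, abs_of_nonneg hs0, mul_pow |b| s] at h
  -- The numbers `15/2`, `3/2`, `4`, `-1/2` are the nonzero values of `b + b² / 2` for `b` in `{±1,
  -- ±2, ±3}`.
  have k1 := abs_le.mp (key (15 / 2) (by norm_num))
  have k2 := abs_le.mp (key (3 / 2) (by norm_num))
  have k3 := abs_le.mp (key 4 (by norm_num))
  have k4 := abs_le.mp (key (-1 / 2) (by norm_num [abs_of_nonneg, abs_of_neg, abs_div]))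
  have hs3 : 0 ≤ s ^ 3 := by positivity
  have habs : |(-1 / 2 : ℝ)| = 1 / 2 := by rw [abs_of_neg] <;> norm_num
  rw [habs] at k4
  simp [Fin.sum_univ_succ] at hlo hup
  norm_num at hlo hup k1 k2 k3 k4
  rw [abs_le]
  constructor <;> linarith [k1.1, k1.2, k2.1, k2.2, k3.1, k3.2, k4.1, k4.2]

/-- The single-letter moment for soft covering: the likelihood ratio of the input `a` against the
equiprobable sign mixture. Bernoulli's inequality and `1/c ≤ 1 - (c - 1) + (c - 1)²` bound it by
exponentials. The coefficient `ρ (1 + ρ) / 2`, divided by `ρ`, tends to `1/2` as `ρ → 0`, the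
leading coefficient in `s` of the mutual information. -/
lemma integral_rpow_le (hv : v ≠ 0) (hs : a ^ 2 / v ≤ 1 / 8) {ρ : ℝ} (hρ : 0 < ρ) (hρ1 : ρ ≤ 1) :
    ∫ y, (Real.exp (a / v * y) / Real.cosh (a / v * y)) ^ ρ ∂gaussianReal a v ≤
      Real.exp (ρ * (1 + ρ) / 2 * (a ^ 2 / v) + 500 * (a ^ 2 / v) ^ 2) := by
  have hup : ∫ y, (Real.exp (a / v * y) / Real.cosh (a / v * y)) ^ ρ ∂gaussianReal a v ≤
      ∫ y, ∑ j, ![1 + 5 * ρ / 2, -3 * ρ / 2, -3 * ρ / 2, ρ / 4, ρ / 4] j *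
        Real.exp (![ρ, ρ + 1, ρ - 1, ρ + 2, ρ - 2] j * (a / v * y)) ∂gaussianReal a v := by
    refine integral_mono_of_nonneg (.of_forall fun y => ?_) (integrable_sum_exp _ _)
      (.of_forall fun y => ?_)
    · have := Real.cosh_pos (a / v * y)
      positivity
    · set x := a / v * y
      have hc := Real.one_le_cosh x
      have hc0 := Real.cosh_pos x
      have h1 : (Real.exp x / Real.cosh x) ^ ρ = Real.exp (ρ * x) * (1 + ((Real.cosh x)⁻¹ - 1)) ^ ρ := by
        rw [div_eq_mul_inv, Real.mul_rpow (Real.exp_pos _).le (by positivity), ← Real.exp_mul,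
          mul_comm x ρ]
        congr 2; ring
      have h2 : (1 + ((Real.cosh x)⁻¹ - 1)) ^ ρ ≤ 1 + ρ * ((Real.cosh x)⁻¹ - 1) :=
        rpow_one_add_le_one_add_mul_self (by
          have : 0 < (Real.cosh x)⁻¹ := by positivity
          linarith) hρ.le hρ1
      have h3 : (Real.cosh x)⁻¹ ≤ 1 - (Real.cosh x - 1) + (Real.cosh x - 1) ^ 2 := by
        rw [inv_le_iff_one_le_mul₀ hc0]
        nlinarith [mul_nonneg (sq_nonneg (Real.cosh x - 1)) (sub_nonneg.mpr hc)]
      have h4 : (1 + ((Real.cosh x)⁻¹ - 1)) ^ ρ ≤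
          1 + 2 * ρ - 3 * ρ * Real.cosh x + ρ * Real.cosh x ^ 2 := by
        nlinarith
      calc (Real.exp x / Real.cosh x) ^ ρ
          ≤ Real.exp (ρ * x) * (1 + 2 * ρ - 3 * ρ * Real.cosh x + ρ * Real.cosh x ^ 2) := by
            rw [h1]; exact mul_le_mul_of_nonneg_left h4 (Real.exp_pos _).le
        _ = _ := by
            rw [cosh_sq_eq, cosh_eq']
            simp only [Fin.sum_univ_succ, Fin.sum_univ_zero]
            simp
            rw [show (ρ + 1) * x = ρ * x + x by ring, show (ρ - 1) * x = ρ * x + -x by ring,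
              show (ρ + 2) * x = ρ * x + 2 * x by ring,
              show (ρ - 2) * x = ρ * x + -(2 * x) by ring]
            simp only [Real.exp_add]
            ring
  rw [integral_sum_exp hv] at hup
  refine hup.trans ?_
  set s : ℝ := a ^ 2 / v with hs_def
  have hs0 : 0 ≤ s := by positivity
  -- The largest value of `b + b² / 2` for `-2 ≤ b ≤ 3` is `15/2`, and `225/4` is its square.
  have key : ∀ b : ℝ, |b| ≤ 15 / 2 → |Real.exp (b * s) - (1 + b * s)| ≤ 225 / 4 * s ^ 2 := by
    intro b hb
    have h := Real.abs_exp_sub_one_sub_id_le (x := b * s) (by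
      rw [abs_mul, abs_of_nonneg hs0]; nlinarith [abs_nonneg b])
    have hb2 : b ^ 2 ≤ 225 / 4 := by
      rw [← sq_abs]; nlinarith [abs_nonneg b]
    rw [← sub_sub]
    refine h.trans ?_
    rw [mul_pow]
    exact mul_le_mul_of_nonneg_right hb2 (sq_nonneg s)
  have hb : ∀ b : ℝ, -2 ≤ b → b ≤ 3 → |b + b ^ 2 / 2| ≤ 15 / 2 := by
    intro b h1 h2
    rw [abs_le]; constructor <;> nlinarith
  have k0 := (abs_le.mp (key _ (hb ρ (by linarith) (by linarith)))).2
  have k1 := (abs_le.mp (key _ (hb (ρ + 1) (by linarith) (by linarith)))).1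
  have k2 := (abs_le.mp (key _ (hb (ρ - 1) (by linarith) (by linarith)))).1
  have k3 := (abs_le.mp (key _ (hb (ρ + 2) (by linarith) (by linarith)))).2
  have k4 := (abs_le.mp (key _ (hb (ρ - 2) (by linarith) (by linarith)))).2
  have hfin : ∑ j, ![1 + 5 * ρ / 2, -3 * ρ / 2, -3 * ρ / 2, ρ / 4, ρ / 4] j *
      Real.exp ((![ρ, ρ + 1, ρ - 1, ρ + 2, ρ - 2] j + ![ρ, ρ + 1, ρ - 1, ρ + 2, ρ - 2] j ^ 2 / 2) *
        s) ≤ 1 + (ρ * (1 + ρ) / 2 * s + 500 * s ^ 2) := by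
    simp only [Fin.sum_univ_succ, Fin.sum_univ_zero]
    simp
    have m0 := mul_le_mul_of_nonneg_left k0 (by linarith : 0 ≤ 1 + 5 * ρ / 2)
    have m1 := mul_le_mul_of_nonneg_left k1 (by linarith : 0 ≤ 3 * ρ / 2)
    have m2 := mul_le_mul_of_nonneg_left k2 (by linarith : 0 ≤ 3 * ρ / 2)
    have m3 := mul_le_mul_of_nonneg_left k3 (by linarith : 0 ≤ ρ / 4)
    have m4 := mul_le_mul_of_nonneg_left k4 (by linarith : 0 ≤ ρ / 4)
    have hρs : ρ * s ^ 2 ≤ s ^ 2 := by nlinarith [sq_nonneg s]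
    have hs2 : 0 ≤ s ^ 2 := sq_nonneg s
    linarith
  refine hfin.trans ?_
  have := Real.add_one_le_exp (ρ * (1 + ρ) / 2 * s + 500 * s ^ 2)
  linarith

end Gaussian

/-! ### The divergence of a BPSK code that is closed under multiplication of sign patterns -/

lemma gaussianReal_eq_withDensity_zero {v : ℝ≥0} (hv : v ≠ 0) (m : ℝ) :
    gaussianReal m v = (gaussianReal 0 v).withDensity
      (fun y => ENNReal.ofReal (Real.exp (m / v * y - m ^ 2 / (2 * v)))) := by
  have hv' : (v : ℝ) ≠ 0 := by exact_mod_cast hv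
  rw [gaussianReal_of_var_ne_zero _ hv, gaussianReal_of_var_ne_zero _ hv,
    ← withDensity_mul _ (measurable_gaussianPDF _ _) (by fun_prop)]
  congr 1
  ext y
  rw [Pi.mul_apply, gaussianPDF, gaussianPDF, ← ENNReal.ofReal_mul (gaussianPDFReal_nonneg _ _ _),
    gaussianPDFReal, gaussianPDFReal, mul_assoc _ (Real.exp _), ← Real.exp_add]
  congr 3
  field_simp
  ring

lemma pi_withDensity_ofReal {n : ℕ} (μ : Measure ℝ) [IsProbabilityMeasure μ] (f : Fin n → ℝ → ℝ)
    (hf : ∀ i, Measurable (f i)) (hf0 : ∀ i y, 0 ≤ f i y)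
    (hprob : ∀ i, IsProbabilityMeasure (μ.withDensity fun y => ENNReal.ofReal (f i y))) :
    Measure.pi (fun i => μ.withDensity fun y => ENNReal.ofReal (f i y)) =
      (Measure.pi fun _ => μ).withDensity (fun y => ENNReal.ofReal (∏ i, f i (y i))) := by
  have hint : ∀ i, Integrable (f i) μ := fun i => by
    refine (lintegral_ofReal_ne_top_iff_integrable (hf i).aestronglyMeasurable
      (.of_forall (hf0 i))).mp ?_
    have := (hprob i).measure_univ
    rw [withDensity_apply _ MeasurableSet.univ, setLIntegral_univ] at this
    rw [this]; simp
  refine Measure.pi_eq fun s hs => ?_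
  rw [withDensity_apply _ (MeasurableSet.univ_pi hs), Measure.restrict_pi_pi,
    ← ofReal_integral_eq_lintegral_ofReal]
  · rw [integral_fintype_prod_eq_prod, ENNReal.ofReal_prod_of_nonneg]
    · refine Finset.prod_congr rfl fun i _ => ?_
      rw [withDensity_apply _ (hs i), ofReal_integral_eq_lintegral_ofReal]
      · exact (hint i).integrableOn
      · exact .of_forall (hf0 i)
    · exact fun i _ => integral_nonneg (hf0 i)
  · exact Integrable.fintype_prod fun i => (hint i).integrableOn
  · exact .of_forall fun y => Finset.prod_nonneg fun i _ => hf0 i _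

lemma klDiv_withDensity {α : Type*} [MeasurableSpace α] {ν : Measure α} [IsProbabilityMeasure ν]
    {q : α → ℝ} (hq : Measurable q) (hpos : ∀ y, 0 < q y)
    [IsProbabilityMeasure (ν.withDensity fun y => ENNReal.ofReal (q y))]
    (hint : Integrable (fun y => Real.log (q y)) (ν.withDensity fun y => ENNReal.ofReal (q y))) :
    InformationTheory.klDiv (ν.withDensity fun y => ENNReal.ofReal (q y)) ν =
      ENNReal.ofReal (∫ y, Real.log (q y) ∂ν.withDensity fun y => ENNReal.ofReal (q y)) := by
  set μ := ν.withDensity fun y => ENNReal.ofReal (q y) with hμ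
  have hac : μ ≪ ν := withDensity_absolutelyContinuous _ _
  have hllr : llr μ ν =ᵐ[μ] fun y => Real.log (q y) := by
    have h := hac.ae_le (Measure.rnDeriv_withDensity ν (f := fun y => ENNReal.ofReal (q y))
      (by fun_prop))
    filter_upwards [h] with y hy
    rw [llr, hy, ENNReal.toReal_ofReal (hpos y).le]
  rw [InformationTheory.klDiv_of_ac_of_integrable hac (hint.congr hllr.symm),
    integral_congr_ae hllr]
  simp

section SignCode

variable {n : ℕ} {v : ℝ≥0} {a : ℝ}

lemma pi_gaussianReal_eq_withDensity (hv : v ≠ 0) (x : Fin n → ℝ) :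
    Measure.pi (fun i => gaussianReal (x i) v) =
      (Measure.pi fun _ : Fin n => gaussianReal 0 v).withDensity
        (fun y => ENNReal.ofReal (∏ i, Real.exp (x i / v * y i - x i ^ 2 / (2 * v)))) := by
  rw [← pi_withDensity_ofReal (gaussianReal 0 v)
    (fun i y => Real.exp (x i / v * y - x i ^ 2 / (2 * v))) (fun i => by fun_prop)
    (fun i y => (Real.exp_pos _).le)]
  · congr 1; ext1 i
    exact gaussianReal_eq_withDensity_zero hv (x i)
  · intro i
    rw [← gaussianReal_eq_withDensity_zero hv (x i)]
    infer_instance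

lemma measurePreserving_sign_mul {s : Fin n → ℝ} (hs : ∀ i, s i = 1 ∨ s i = -1)
    (x : Fin n → ℝ) :
    MeasurePreserving (fun (y : Fin n → ℝ) i => s i * y i)
      (Measure.pi fun i => gaussianReal (x i) v)
      (Measure.pi fun i => gaussianReal (s i * x i) v) := by
  refine measurePreserving_pi _ _ fun i => ⟨by fun_prop, ?_⟩
  rw [gaussianReal_map_const_mul]
  congr 1
  have : (NNReal.mk (s i ^ 2) (sq_nonneg _)) = 1 := by
    ext; rcases hs i with h | h <;> simp [h]
  rw [this, one_mul]

variable {U : Type*} [Fintype U] {w : U → Fin n → ℝ}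

/-- The mixture `|U|⁻¹ ∑ᵤ ∏ᵢ exp (t wᵤᵢ yᵢ)`. -/
def expMix (t : ℝ) (w : U → Fin n → ℝ) (y : Fin n → ℝ) : ℝ :=
  (1 / (Fintype.card U : ℝ)) * ∑ u, ∏ i, Real.exp (t * w u i * y i)

/-- The output distribution of a uniformly chosen codeword `a wᵤ`. -/
def mixDist (a : ℝ) (v : ℝ≥0) (w : U → Fin n → ℝ) : Measure (Fin n → ℝ) :=
  (Fintype.card U : ℝ≥0∞)⁻¹ • ∑ u, Measure.pi fun i => gaussianReal (a * w u i) v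

/-- The divergence of the output distribution of a code from the output distribution of
independent equiprobable input signs. -/
def resolvability (a : ℝ) (v : ℝ≥0) (w : U → Fin n → ℝ) : ℝ :=
  ∫ y, (Real.log (expMix (a / v) w y) - ∑ i, Real.log (Real.cosh (a / v * y i)))
    ∂Measure.pi fun _ : Fin n => gaussianReal a v

lemma continuous_expMix (t : ℝ) (w : U → Fin n → ℝ) : Continuous (expMix t w) := by
  unfold expMix; fun_prop

/-- Multiplying by the signs of a codeword merely permutes the summands, since the code is closed
under this multiplication. -/
lemma expMix_sign_mul [AddCommGroup U] (hadd : ∀ u u' i, w (u + u') i = w u i * w u' i) (t : ℝ) (u : U)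
    (y : Fin n → ℝ) : expMix t w (fun i => w u i * y i) = expMix t w y := by
  unfold expMix
  congr 1
  rw [← Equiv.sum_comp (Equiv.addRight u) (fun u => ∏ i, Real.exp (t * w u i * y i))]
  refine Finset.sum_congr rfl fun u' _ => Finset.prod_congr rfl fun i _ => ?_
  simp only [Equiv.coe_addRight, hadd]
  congr 1; ring

variable [Nonempty U]

lemma card_pos_real : 0 < (Fintype.card U : ℝ) := by
  exact_mod_cast Fintype.card_pos

lemma expMix_pos (t : ℝ) (w : U → Fin n → ℝ) (y : Fin n → ℝ) : 0 < expMix t w y := by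
  have := card_pos_real (U := U)
  exact mul_pos (by positivity) (Finset.sum_pos (fun u _ => Finset.prod_pos fun i _ =>
    Real.exp_pos _) Finset.univ_nonempty)

instance (w : U → Fin n → ℝ) : IsProbabilityMeasure (mixDist a v w) where
  measure_univ := by
    have hne : (Fintype.card U : ℝ≥0∞) ≠ 0 := by simp [Fintype.card_ne_zero]
    simp only [mixDist, Measure.smul_apply, Measure.coe_finsetSum, Finset.sum_apply,
      measure_univ, Finset.sum_const, Finset.card_univ, nsmul_eq_mul, mul_one, smul_eq_mul]
    exact ENNReal.inv_mul_cancel hne (by simp)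

lemma mixDist_eq_withDensity (hv : v ≠ 0) (hw : ∀ u i, w u i = 1 ∨ w u i = -1) :
    mixDist a v w = (Measure.pi fun _ : Fin n => gaussianReal 0 v).withDensity
      (fun y => ENNReal.ofReal (Real.exp (-(n * (a ^ 2 / v) / 2)) * expMix (a / v) w y)) := by
  have hc := card_pos_real (U := U)
  have hv' : (v : ℝ) ≠ 0 := by exact_mod_cast hv
  have hsum : ∑ u, Measure.pi (fun i => gaussianReal (a * w u i) v) =
      (Measure.pi fun _ : Fin n => gaussianReal 0 v).withDensity (fun y => ∑ u : U,
        ENNReal.ofReal (∏ i, Real.exp (a * w u i / v * y i - (a * w u i) ^ 2 / (2 * v)))) := by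
    rw [Finset.sum_congr rfl fun u _ => pi_gaussianReal_eq_withDensity hv _]
    ext s hs
    rw [withDensity_apply _ hs, lintegral_finsetSum _ fun u _ => by fun_prop]
    simp only [withDensity_apply _ hs, Measure.coe_finsetSum, Finset.sum_apply]
  rw [mixDist, hsum, ← withDensity_smul _ (by fun_prop)]
  congr 1
  ext y
  rw [Pi.smul_apply, smul_eq_mul, ← ENNReal.ofReal_sum_of_nonneg fun u _ =>
    Finset.prod_nonneg fun i _ => (Real.exp_pos _).le]
  have : (Fintype.card U : ℝ≥0∞)⁻¹ = ENNReal.ofReal (1 / (Fintype.card U : ℝ)) := by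
    rw [one_div, ENNReal.ofReal_inv_of_pos hc, ENNReal.ofReal_natCast]
  rw [this, ← ENNReal.ofReal_mul (by positivity), expMix]
  congr 1
  rw [← mul_assoc, mul_comm (Real.exp _), mul_assoc, Finset.mul_sum (a := Real.exp _)]
  congr 1
  refine Finset.sum_congr rfl fun u _ => ?_
  have h2 : ∀ i, w u i ^ 2 = 1 := fun i => by rcases hw u i with h | h <;> simp [h]
  rw [← Real.exp_sum, ← Real.exp_sum, ← Real.exp_add]
  congr 1
  simp_rw [mul_pow, h2]
  rw [Finset.sum_sub_distrib]
  simp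
  rw [sub_eq_neg_add]
  congr 1
  · field_simp
  · exact Finset.sum_congr rfl fun i _ => by ring

lemma abs_log_expMix_le (hw : ∀ u i, w u i = 1 ∨ w u i = -1) (t : ℝ) (y : Fin n → ℝ) :
    |Real.log (expMix t w y)| ≤ ∑ i, |t * y i| := by
  have hc := card_pos_real (U := U)
  have hterm : ∀ u i, |t * w u i * y i| ≤ |t * y i| := by
    intro u i
    rcases hw u i with h | h <;> simp [h]
  rw [abs_le]
  constructor
  · rw [Real.le_log_iff_exp_le (expMix_pos _ _ _), expMix]
    have : ∑ u : U, Real.exp (-∑ i, |t * y i|) ≤ ∑ u, ∏ i, Real.exp (t * w u i * y i) := by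
      refine Finset.sum_le_sum fun u _ => ?_
      rw [← Real.exp_sum, ← Finset.sum_neg_distrib]
      refine Real.exp_le_exp.mpr (Finset.sum_le_sum fun i _ => ?_)
      linarith [neg_abs_le (t * w u i * y i), hterm u i]
    simp only [Finset.sum_const, Finset.card_univ, nsmul_eq_mul] at this
    rw [div_mul_eq_mul_div, one_mul, le_div_iff₀ hc]
    linarith
  · rw [Real.log_le_iff_le_exp (expMix_pos _ _ _), expMix]
    have : ∑ u, ∏ i, Real.exp (t * w u i * y i) ≤ ∑ u : U, Real.exp (∑ i, |t * y i|) := by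
      refine Finset.sum_le_sum fun u _ => ?_
      rw [← Real.exp_sum]
      refine Real.exp_le_exp.mpr (Finset.sum_le_sum fun i _ => ?_)
      linarith [le_abs_self (t * w u i * y i), hterm u i]
    simp only [Finset.sum_const, Finset.card_univ, nsmul_eq_mul] at this
    rw [div_mul_eq_mul_div, one_mul, div_le_iff₀ hc]
    linarith

lemma integrable_log_expMix (hw : ∀ u i, w u i = 1 ∨ w u i = -1) (t : ℝ) (x : Fin n → ℝ) :
    Integrable (fun y => Real.log (expMix t w y)) (Measure.pi fun i => gaussianReal (x i) v) := by
  refine Integrable.mono' (g := fun y => ∑ i, |t * y i|) ?_ ?_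
    (.of_forall fun y => abs_log_expMix_le hw t y)
  · refine integrable_finsetSum _ fun i _ => ?_
    refine integrable_comp_eval (μ := fun i => gaussianReal (x i) v) (f := fun y => |t * y|) ?_
    exact (((memLp_id_gaussianReal 1).integrable le_rfl).const_mul t).abs
  · exact (Continuous.log (continuous_expMix t w) fun y =>
      (expMix_pos t w y).ne').aestronglyMeasurable

lemma integrable_sum_log_cosh (t : ℝ) (x : Fin n → ℝ) :
    Integrable (fun y => ∑ i, Real.log (Real.cosh (t * y i)))
      (Measure.pi fun i => gaussianReal (x i) v) := by
  refine integrable_finsetSum _ fun i _ => ?_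
  refine integrable_comp_eval (μ := fun i => gaussianReal (x i) v)
    (f := fun y => Real.log (Real.cosh (t * y))) ?_
  refine Integrable.mono' (((memLp_id_gaussianReal 1).integrable le_rfl).const_mul t).abs
    (continuous_log_cosh t).aestronglyMeasurable (.of_forall fun y => ?_)
  rw [Real.norm_of_nonneg (log_cosh_nonneg _), Real.log_le_iff_le_exp (Real.cosh_pos _),
    ← Real.cosh_abs, Real.cosh_eq]
  have : Real.exp (-|t * y|) ≤ Real.exp |t * y| :=
    Real.exp_le_exp.mpr (by linarith [abs_nonneg (t * y)])
  simp only [id]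
  linarith

/-- Each component of the mixture is the image of the all-`a` component under a sign flip that
leaves `f` unchanged. Expectations under the code thus reduce to a single product Gaussian. -/
lemma integral_mixDist (hw : ∀ u i, w u i = 1 ∨ w u i = -1) {f : (Fin n → ℝ) → ℝ}
    (hint : ∀ x : Fin n → ℝ, Integrable f (Measure.pi fun i => gaussianReal (x i) v))
    (hf : ∀ u y, f (fun i => w u i * y i) = f y) :
    ∫ y, f y ∂mixDist a v w = ∫ y, f y ∂Measure.pi fun _ : Fin n => gaussianReal a v := by
  have h : ∀ u, ∫ y, f y ∂(Measure.pi fun i => gaussianReal (a * w u i) v) =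
      ∫ y, f y ∂Measure.pi fun _ : Fin n => gaussianReal a v := by
    intro u
    have hmp := measurePreserving_sign_mul (v := v) (hw u) (fun _ => a)
    simp_rw [mul_comm a]
    rw [← hmp.map_eq, integral_map hmp.measurable.aemeasurable
      (by rw [hmp.map_eq]; exact (hint _).aestronglyMeasurable)]
    simp_rw [hf]
  have hc := card_pos_real (U := U)
  rw [mixDist, integral_smul_measure, integral_finsetSum_measure fun u _ => hint _]
  simp_rw [h]
  simp [hc.ne']

lemma integrable_mixDist {f : (Fin n → ℝ) → ℝ}
    (hint : ∀ x : Fin n → ℝ, Integrable f (Measure.pi fun i => gaussianReal (x i) v)) :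
    Integrable f (mixDist a v w) :=
  Integrable.smul_measure (integrable_finsetSum_measure.mpr fun u _ => hint _)
    (by simp [Fintype.card_ne_zero])

/-- The log-density is `log expMix` minus `n a² / (2 v)`, and its expectation may be taken under the
all-`a` product. Adding and subtracting the sum of `log cosh` separates the memoryless divergence
from the excess due to the finite code. -/
lemma klDiv_mixDist [AddCommGroup U] (hv : v ≠ 0) (hw : ∀ u i, w u i = 1 ∨ w u i = -1)
    (hadd : ∀ u u' i, w (u + u') i = w u i * w u' i) :
    InformationTheory.klDiv (mixDist a v w) (Measure.pi fun _ : Fin n => gaussianReal 0 v) =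
      ENNReal.ofReal (n * bpskDiv a v + resolvability a v w) := by
  have hlog : ∀ y, Real.log (Real.exp (-(n * (a ^ 2 / v) / 2)) * expMix (a / v) w y) =
      -(n * (a ^ 2 / v) / 2) + Real.log (expMix (a / v) w y) := fun y => by
    rw [Real.log_mul (Real.exp_pos _).ne' (expMix_pos _ _ _).ne', Real.log_exp]
  have hint := fun x => integrable_log_expMix (v := v) hw (a / v) x
  have key : ∫ y, (-(n * (a ^ 2 / v) / 2) + Real.log (expMix (a / v) w y)) ∂mixDist a v w =
      n * bpskDiv a v + resolvability a v w := by
    rw [integral_add (integrable_const _) (integrable_mixDist hint),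
      integral_mixDist hw hint fun u y => by rw [expMix_sign_mul hadd], resolvability,
      integral_sub (hint _) (integrable_sum_log_cosh _ _), integral_finsetSum _ fun i _ =>
        integrable_comp_eval (μ := fun _ : Fin n => gaussianReal a v) integrable_log_cosh]
    have : ∀ i : Fin n, ∫ y, Real.log (Real.cosh (a / v * y i))
        ∂(Measure.pi fun _ : Fin n => gaussianReal a v) = bpskDiv a v + a ^ 2 / v / 2 := by
      intro i
      rw [integral_comp_eval (μ := fun _ : Fin n => gaussianReal a v)
        (f := fun y => Real.log (Real.cosh (a / v * y)))
        (continuous_log_cosh _).aestronglyMeasurable]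
      unfold bpskDiv; ring
    simp_rw [this]
    simp
    ring
  have hD := mixDist_eq_withDensity (a := a) hv hw
  have hprob : IsProbabilityMeasure (mixDist a v w) := inferInstance
  have hint2 : Integrable (fun y => -(n * (a ^ 2 / v) / 2) + Real.log (expMix (a / v) w y))
      (mixDist a v w) := (integrable_const _).add (integrable_mixDist hint)
  rw [← key]
  simp_rw [← hlog] at hint2 ⊢
  rw [hD] at hprob hint2 ⊢
  refine klDiv_withDensity ?_ (fun y => mul_pos (Real.exp_pos _) (expMix_pos _ _ _)) hint2
  exact ((continuous_expMix _ _).measurable.const_mul _)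

/-- Gibbs' inequality: the ratio of the density for independent signs to the density of the code has
mean one under the code, and `log x ≤ x - 1`. Nonnegativity makes the first-moment selection of `g`
possible and keeps the divergence from falling short of its target. -/
lemma resolvability_nonneg [AddCommGroup U] (hv : v ≠ 0) (hw : ∀ u i, w u i = 1 ∨ w u i = -1)
    (hadd : ∀ u u' i, w (u + u') i = w u i * w u' i) : 0 ≤ resolvability a v w := by
  have hint : ∀ x : Fin n → ℝ, Integrable (fun y => Real.log (expMix (a / v) w y) -
      ∑ i, Real.log (Real.cosh (a / v * y i))) (Measure.pi fun i => gaussianReal (x i) v) :=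
    fun x => (integrable_log_expMix hw _ x).sub (integrable_sum_log_cosh _ x)
  have hcosh : ∀ u (y : Fin n → ℝ) i,
      Real.cosh (a / v * (w u i * y i)) = Real.cosh (a / v * y i) := by
    intro u y i
    rcases hw u i with h | h <;> simp [h]
  rw [resolvability, ← integral_mixDist hw hint fun u y => by
    rw [expMix_sign_mul hadd]; simp_rw [hcosh]]
  have hv' : (v : ℝ) ≠ 0 := by exact_mod_cast hv
  -- the density ratio
  set F : (Fin n → ℝ) → ℝ := fun y => (∏ i, Real.cosh (a / v * y i)) / expMix (a / v) w y with hF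
  have hdens : Measurable fun y : Fin n → ℝ =>
      ENNReal.ofReal (Real.exp (-(n * (a ^ 2 / v) / 2)) * expMix (a / v) w y) :=
    ((continuous_expMix _ _).measurable.const_mul _).ennreal_ofReal
  have hcancel : ∀ y, (ENNReal.ofReal (Real.exp (-(n * (a ^ 2 / v) / 2)) *
      expMix (a / v) w y)).toReal • F y =
      Real.exp (-(n * (a ^ 2 / v) / 2)) * ∏ i, Real.cosh (a / v * y i) := by
    intro y
    have := expMix_pos (a / v) w y
    rw [ENNReal.toReal_ofReal (by positivity), hF, smul_eq_mul]
    field_simp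
  have hcint : Integrable (fun y => Real.cosh (a / v * y)) (gaussianReal 0 v) := by
    simp_rw [cosh_eq', ← mul_assoc]
    exact ((integrable_exp_mul_gaussianReal _).div_const 2).add
      ((integrable_exp_mul_gaussianReal _).div_const 2)
  have hFint : Integrable F (mixDist a v w) := by
    rw [mixDist_eq_withDensity hv hw, integrable_withDensity_iff_integrable_smul' hdens
      (.of_forall fun y => ENNReal.ofReal_lt_top)]
    simp_rw [hcancel]
    exact (Integrable.fintype_prod (f := fun _ y => Real.cosh (a / v * y))
      (μ := fun _ => gaussianReal 0 v) fun _ => hcint).const_mul _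
  have hF1 : ∫ y, F y ∂mixDist a v w = 1 := by
    rw [mixDist_eq_withDensity hv hw, integral_withDensity_eq_integral_toReal_smul hdens
      (.of_forall fun y => ENNReal.ofReal_lt_top)]
    simp_rw [hcancel]
    rw [integral_const_mul, integral_fintype_prod_eq_prod (fun _ y => Real.cosh (a / v * y))]
    have h1 : ∀ b : ℝ, ∫ y, Real.exp (b * y) ∂gaussianReal 0 v = Real.exp (v * b ^ 2 / 2) := by
      intro b
      have := congrFun (mgf_fun_id_gaussianReal (μ := 0) (v := v)) b
      simpa [mgf] using this
    have h2 : ∫ y, Real.cosh (a / v * y) ∂gaussianReal 0 v = Real.exp (a ^ 2 / v / 2) := by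
      simp_rw [cosh_eq', ← mul_assoc]
      rw [integral_add ((integrable_exp_mul_gaussianReal _).div_const 2)
        ((integrable_exp_mul_gaussianReal _).div_const 2), integral_div, integral_div, h1, h1]
      have e1 : (v : ℝ) * (1 * (a / v)) ^ 2 / 2 = a ^ 2 / v / 2 := by field_simp
      have e2 : (v : ℝ) * (-1 * (a / v)) ^ 2 / 2 = a ^ 2 / v / 2 := by field_simp
      rw [e1, e2]; ring
    simp only [h2, Finset.prod_const, Finset.card_univ, Fintype.card_fin]
    rw [← Real.exp_nat_mul, ← Real.exp_add, Real.exp_eq_one_iff]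
    ring
  calc (0 : ℝ) = ∫ y, (1 - F y) ∂mixDist a v w := by
        rw [integral_sub (integrable_const _) hFint, hF1]; simp
    _ ≤ _ := by
        refine integral_mono ((integrable_const _).sub hFint) (integrable_mixDist hint) fun y => ?_
        have hz := expMix_pos (a / v) w y
        have hp : 0 < ∏ i, Real.cosh (a / v * y i) := Finset.prod_pos fun i _ => Real.cosh_pos _
        have h := Real.log_le_sub_one_of_pos (div_pos hp hz)
        rw [Real.log_div hp.ne' hz.ne', Real.log_prod fun i _ => (Real.cosh_pos _).ne'] at h
        simp only [hF]
        linarith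

end SignCode

/-! ### Random linear sign codes -/

section Chi

lemma add_eq_zero_iff_eq {ι : Type*} (u u' : ι → ZMod 2) : u + u' = 0 ↔ u = u' := by
  have : ∀ a b : ZMod 2, a + b = 0 ↔ a = b := by decide
  simp only [funext_iff, Pi.add_apply, Pi.zero_apply, this]

variable {ι : Type*} [Fintype ι]

/-- The sign pairing on `ZMod 2`. -/
def sgn (a b : ZMod 2) : ℝ := if a = 1 ∧ b = 1 then -1 else 1

/-- The characters `(-1) ^ ⟨u, g⟩` of `ι → ZMod 2`. -/
def chi (u g : ι → ZMod 2) : ℝ := ∏ j, sgn (u j) (g j)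

lemma sgn_add_left (a a' b : ZMod 2) : sgn (a + a') b = sgn a b * sgn a' b := by
  have h : ∀ a a' b : ZMod 2, (if a + a' = 1 ∧ b = 1 then (-1 : ℤ) else 1) =
      (if a = 1 ∧ b = 1 then -1 else 1) * (if a' = 1 ∧ b = 1 then -1 else 1) := by decide
  have := congrArg (Int.cast : ℤ → ℝ) (h a a' b)
  simpa only [sgn, Int.cast_mul, Int.cast_ite, Int.cast_neg, Int.cast_one] using this

lemma sgn_comm (a b : ZMod 2) : sgn a b = sgn b a := by simp [sgn, and_comm]

lemma chi_comm (u g : ι → ZMod 2) : chi u g = chi g u := by simp [chi, sgn_comm]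

lemma chi_add_left (u u' g : ι → ZMod 2) : chi (u + u') g = chi u g * chi u' g := by
  simp [chi, sgn_add_left, Finset.prod_mul_distrib]

lemma chi_zero_left (g : ι → ZMod 2) : chi 0 g = 1 := by simp [chi, sgn]

lemma chi_eq_or (u g : ι → ZMod 2) : chi u g = 1 ∨ chi u g = -1 := by
  unfold chi
  refine Finset.prod_induction _ (fun x : ℝ => x = 1 ∨ x = -1) ?_ (Or.inl rfl) ?_
  · rintro a b (rfl | rfl) (rfl | rfl) <;> simp
  · intro j _
    unfold sgn; split_ifs <;> simp

variable [DecidableEq ι]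

lemma sum_chi_eq_zero {u : ι → ZMod 2} (hu : u ≠ 0) : ∑ g, chi u g = 0 := by
  obtain ⟨j, hj⟩ := Function.ne_iff.mp hu
  have h := Finset.prod_univ_sum (fun _ : ι => (Finset.univ : Finset (ZMod 2)))
    (fun j b => sgn (u j) b)
  rw [Fintype.piFinset_univ] at h
  simp only [chi]
  rw [← h]
  refine Finset.prod_eq_zero (Finset.mem_univ j) ?_
  have h1 : u j = 1 := by
    have : ∀ x : ZMod 2, x ≠ 0 → x = 1 := by decide
    exact this _ hj
  rw [h1, show (Finset.univ : Finset (ZMod 2)) = {0, 1} from rfl,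
    Finset.sum_pair (by decide)]
  simp [sgn]

lemma sum_chi_mul_chi (g g' : ι → ZMod 2) :
    ∑ u, chi u g * chi u g' = if g = g' then (Fintype.card (ι → ZMod 2) : ℝ) else 0 := by
  have : ∀ u, chi u g * chi u g' = chi (g + g') u := fun u => by
    rw [chi_add_left, chi_comm u, chi_comm u]
  simp_rw [this]
  split_ifs with h
  · rw [(add_eq_zero_iff_eq g g').mpr h]; simp [chi_zero_left]
  · exact sum_chi_eq_zero fun h' => h ((add_eq_zero_iff_eq g g').mp h')

lemma sum_comp_chi {u : ι → ZMod 2} (hu : u ≠ 0) (F : ℝ → ℝ) :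
    ∑ g, F (chi u g) = Fintype.card (ι → ZMod 2) * ((F 1 + F (-1)) / 2) := by
  have : ∀ g, F (chi u g) = (F 1 + F (-1)) / 2 + (F 1 - F (-1)) / 2 * chi u g := by
    intro g
    rcases chi_eq_or u g with h | h <;> rw [h] <;> ring
  simp_rw [this]
  rw [Finset.sum_add_distrib, ← Finset.mul_sum, sum_chi_eq_zero hu]
  simp

/-- For uniform `g`, the codeword of any fixed nonzero `u` consists of independent fair signs. -/
lemma sum_prod_chi {n : ℕ} {u : ι → ZMod 2} (hu : u ≠ 0) (F : Fin n → ℝ → ℝ) :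
    ∑ g : Fin n → ι → ZMod 2, ∏ i, F i (chi u (g i)) =
      Fintype.card (Fin n → ι → ZMod 2) * ∏ i, ((F i 1 + F i (-1)) / 2) := by
  have h := Finset.prod_univ_sum (fun _ : Fin n => (Finset.univ : Finset (ι → ZMod 2)))
    (fun i g => F i (chi u g))
  rw [Fintype.piFinset_univ] at h
  rw [← h]
  simp_rw [sum_comp_chi hu]
  rw [Finset.prod_mul_distrib]
  simp

/-- Orthogonality expands the collision indicator over all `u`; after averaging over `g` only `u =
0` survives. -/
lemma sum_collision {n : ℕ} {i j : Fin n} (hij : i ≠ j) :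
    ∑ g : Fin n → ι → ZMod 2, (if g i = g j then (1 : ℝ) else 0) =
      Fintype.card (Fin n → ι → ZMod 2) / Fintype.card (ι → ZMod 2) := by
  have hA : (0 : ℝ) < Fintype.card (ι → ZMod 2) := by exact_mod_cast Fintype.card_pos
  have h1 : ∀ g : Fin n → ι → ZMod 2, (if g i = g j then (1 : ℝ) else 0) =
      (∑ u, chi u (g i) * chi u (g j)) / Fintype.card (ι → ZMod 2) := by
    intro g
    rw [sum_chi_mul_chi]
    split_ifs
    · rw [div_self hA.ne']
    · simp
  simp_rw [h1]
  rw [← Finset.sum_div, Finset.sum_comm, Finset.sum_eq_single 0]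
  · simp [chi_zero_left]
  · intro u _ hu
    have h2 : ∀ g : Fin n → ι → ZMod 2, chi u (g i) * chi u (g j) =
        ∏ k, (fun x : ℝ => if k = i ∨ k = j then x else 1) (chi u (g k)) := by
      intro g
      rw [← Finset.prod_pair (f := fun k => chi u (g k)) hij, Finset.prod_ite]
      simp only [Finset.prod_const_one, mul_one]
      refine Finset.prod_congr ?_ fun _ _ => rfl
      ext k; simp
    rw [Finset.sum_congr rfl fun g _ => h2 g,
      sum_prod_chi hu fun k x => if k = i ∨ k = j then x else 1, Finset.prod_eq_zero (Finset.mem_univ i)]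
    · simp
    · simp
  · simp

lemma log_one_add_le_rpow {z ρ : ℝ} (hz : 0 ≤ z) (hρ : 0 < ρ) (hρ1 : ρ ≤ 1) :
    Real.log (1 + z) ≤ z ^ ρ / ρ := by
  have h1 : (1 + z) ^ ρ ≤ 1 + z ^ ρ := by
    have := Real.rpow_add_le_add_rpow zero_le_one hz hρ.le hρ1
    rwa [Real.one_rpow] at this
  have h2 := Real.log_le_sub_one_of_pos (x := (1 + z) ^ ρ) (by positivity)
  rw [Real.log_rpow (by positivity)] at h2
  rw [le_div_iff₀ hρ]
  linarith

/-- Soft covering. The output is that of the zero codeword, whose own term contributes `W / L`,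
while every other codeword averages to the independent-sign mixture. Jensen gives `log (1 + W / L)`,
which `log_one_add_le_rpow` replaces by a `ρ`-th moment that factorizes over coordinates. -/
lemma sum_resolvability_le {n : ℕ} {a : ℝ} {v : ℝ≥0} (hv : v ≠ 0) (hs : a ^ 2 / v ≤ 1 / 8) {ρ : ℝ}
    (hρ : 0 < ρ) (hρ1 : ρ ≤ 1) :
    ∑ g : Fin n → ι → ZMod 2, resolvability a v (fun u i => chi u (g i)) ≤
      Fintype.card (Fin n → ι → ZMod 2) * (1 / ρ *
        (Real.exp (n * (ρ * (1 + ρ) / 2 * (a ^ 2 / v) + 500 * (a ^ 2 / v) ^ 2)) /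
          (Fintype.card (ι → ZMod 2) : ℝ) ^ ρ)) := by
  set L : ℝ := ((Fintype.card (ι → ZMod 2) : ℕ) : ℝ) with hL
  set N : ℝ := ((Fintype.card (Fin n → ι → ZMod 2) : ℕ) : ℝ) with hN
  have hL0 : 0 < L := by rw [hL]; exact_mod_cast Fintype.card_pos
  have hN0 : 0 < N := by rw [hN]; exact_mod_cast Fintype.card_pos
  set t := a / v with ht
  have hint : ∀ g : Fin n → ι → ZMod 2, Integrable (fun y =>
      Real.log (expMix t (fun u i => chi u (g i)) y) - ∑ i, Real.log (Real.cosh (t * y i)))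
      (Measure.pi fun _ : Fin n => gaussianReal a v) := fun g =>
    (integrable_log_expMix (fun u i => chi_eq_or u (g i)) _ fun _ => a).sub
      (integrable_sum_log_cosh _ fun _ => a)
  have hbint : Integrable (fun y => (Real.exp (t * y) / Real.cosh (t * y)) ^ ρ)
      (gaussianReal a v) := by
    refine Integrable.of_bound (C := 2) ?_ (.of_forall fun y => ?_)
    · refine Continuous.aestronglyMeasurable ?_
      refine Continuous.rpow_const (Continuous.div (by fun_prop) (by fun_prop)
        fun y => (Real.cosh_pos _).ne') fun y => Or.inr hρ.le
    · have hc := Real.cosh_pos (t * y)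
      rw [Real.norm_of_nonneg (by positivity)]
      have h2 : Real.exp (t * y) / Real.cosh (t * y) ≤ 2 := by
        rw [div_le_iff₀ hc, Real.cosh_eq]
        linarith [Real.exp_pos (-(t * y))]
      calc _ ≤ (2 : ℝ) ^ ρ := Real.rpow_le_rpow (by positivity) h2 hρ.le
        _ ≤ 2 ^ (1 : ℝ) := Real.rpow_le_rpow_of_exponent_le (by norm_num) hρ1
        _ = 2 := Real.rpow_one 2
  have hpoint : ∀ y : Fin n → ℝ, ∑ g : Fin n → ι → ZMod 2,
      (Real.log (expMix t (fun u i => chi u (g i)) y) - ∑ i, Real.log (Real.cosh (t * y i))) ≤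
      N * (1 / ρ * (1 / L ^ ρ)) * ∏ i, (Real.exp (t * y i) / Real.cosh (t * y i)) ^ ρ := by
    intro y
    set W := ∏ i, (Real.exp (t * y i) / Real.cosh (t * y i)) with hW
    set zb := ∏ i, Real.cosh (t * y i) with hzb
    have hzb0 : 0 < zb := Finset.prod_pos fun i _ => Real.cosh_pos _
    have hW0 : 0 < W := Finset.prod_pos fun i _ => div_pos (Real.exp_pos _) (Real.cosh_pos _)
    set A := 1 + W / L with hA
    have hA0 : 0 < A := by positivity
    set Z : (Fin n → ι → ZMod 2) → ℝ := fun g => expMix t (fun u i => chi u (g i)) y / zb with hZ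
    have hZ0 : ∀ g, 0 < Z g := fun g => div_pos (expMix_pos _ _ _) hzb0
    have hlogZ : ∀ g, Real.log (expMix t (fun u i => chi u (g i)) y) -
        ∑ i, Real.log (Real.cosh (t * y i)) = Real.log (Z g) := by
      intro g
      rw [hZ, Real.log_div (expMix_pos _ _ _).ne' hzb0.ne', hzb,
        Real.log_prod fun i _ => (Real.cosh_pos _).ne']
    have hsumZ : ∑ g, Z g ≤ N * A := by
      have hu : ∀ u : ι → ZMod 2, ∑ g : Fin n → ι → ZMod 2,
          ∏ i, Real.exp (t * chi u (g i) * y i) = if u = 0 then N * (W * zb) else N * zb := by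
        intro u
        split_ifs with h
        · rw [h]
          simp only [chi_zero_left, mul_one, Finset.sum_const, Finset.card_univ, nsmul_eq_mul]
          rw [← hN, hW, hzb, ← Finset.prod_mul_distrib]
          congr 1
          exact Finset.prod_congr rfl fun i _ =>
            (div_mul_cancel₀ _ (Real.cosh_pos _).ne').symm
        · rw [sum_prod_chi h (fun i x => Real.exp (t * x * y i)), ← hN, hzb]
          congr 1
          refine Finset.prod_congr rfl fun i _ => ?_
          rw [Real.cosh_eq]; ring_nf
      have h1 : ∑ g, Z g = 1 / L * ∑ u : ι → ZMod 2,
          (if u = 0 then N * (W * zb) else N * zb) / zb := by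
        simp only [hZ, expMix]
        rw [← Finset.sum_div, ← Finset.mul_sum, Finset.sum_comm]
        simp_rw [hu]
        rw [← hL, mul_div_assoc, Finset.sum_div]
      rw [h1]
      have h2 : ∀ u : ι → ZMod 2, (if u = 0 then N * (W * zb) else N * zb) / zb ≤
          (if u = 0 then N * W else 0) + N := by
        intro u
        split_ifs
        · rw [← mul_assoc, mul_div_cancel_right₀ _ hzb0.ne']; linarith
        · rw [mul_div_cancel_right₀ _ hzb0.ne']; linarith
      calc _ ≤ 1 / L * ∑ u : ι → ZMod 2, ((if u = 0 then N * W else 0) + N) :=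
            mul_le_mul_of_nonneg_left (Finset.sum_le_sum fun u _ => h2 u) (by positivity)
        _ = N * A := by
            rw [Finset.sum_add_distrib, Finset.sum_ite_eq' Finset.univ (0 : ι → ZMod 2)]
            simp only [Finset.mem_univ, if_true, Finset.sum_const, Finset.card_univ, nsmul_eq_mul]
            rw [← hL, hA]; field_simp; ring
    have hlogA : ∑ g, Real.log (Z g) ≤ N * Real.log A := by
      -- Jensen's inequality through the tangent of `log` at `A`.
      calc ∑ g, Real.log (Z g) ≤ ∑ g, (Real.log A + (Z g / A - 1)) := by
            refine Finset.sum_le_sum fun g _ => ?_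
            have := Real.log_le_sub_one_of_pos (div_pos (hZ0 g) hA0)
            rw [Real.log_div (hZ0 g).ne' hA0.ne'] at this
            linarith
        _ = N * Real.log A + ((∑ g, Z g) / A - N) := by
            rw [Finset.sum_add_distrib, Finset.sum_sub_distrib, ← Finset.sum_div]
            simp [hN]
        _ ≤ _ := by
            have : (∑ g, Z g) / A ≤ N := by rwa [div_le_iff₀ hA0]
            linarith
    simp_rw [hlogZ]
    refine hlogA.trans ?_
    rw [Real.finsetProd_rpow _ _ fun i _ =>
      (div_pos (Real.exp_pos _) (Real.cosh_pos _)).le, ← hW, mul_assoc]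
    refine mul_le_mul_of_nonneg_left ((log_one_add_le_rpow (by positivity) hρ hρ1).trans_eq ?_)
      hN0.le
    rw [Real.div_rpow hW0.le hL0.le]
    field_simp
  have hsum : ∑ g : Fin n → ι → ZMod 2, resolvability a v (fun u i => chi u (g i)) =
      ∫ y, ∑ g : Fin n → ι → ZMod 2, (Real.log (expMix t (fun u i => chi u (g i)) y) -
        ∑ i, Real.log (Real.cosh (t * y i))) ∂Measure.pi fun _ : Fin n => gaussianReal a v := by
    rw [integral_finsetSum _ fun g _ => hint g]; rfl
  rw [hsum]
  calc _ ≤ ∫ y, N * (1 / ρ * (1 / L ^ ρ)) * ∏ i, (Real.exp (t * y i) / Real.cosh (t * y i)) ^ ρ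
        ∂Measure.pi fun _ : Fin n => gaussianReal a v := by
        refine integral_mono (integrable_finsetSum _ fun g _ => hint g) ?_ hpoint
        exact (Integrable.fintype_prod
          (f := fun (_ : Fin n) y => (Real.exp (t * y) / Real.cosh (t * y)) ^ ρ)
          (μ := fun _ => gaussianReal a v) fun _ => hbint).const_mul _
    _ = N * (1 / ρ * (1 / L ^ ρ)) *
        (∫ y, (Real.exp (t * y) / Real.cosh (t * y)) ^ ρ ∂gaussianReal a v) ^ n := by
        rw [integral_const_mul, integral_fintype_prod_eq_prod
          (fun _ y => (Real.exp (t * y) / Real.cosh (t * y)) ^ ρ)]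
        simp
    _ ≤ N * (1 / ρ * (1 / L ^ ρ)) *
        (Real.exp (ρ * (1 + ρ) / 2 * (a ^ 2 / v) + 500 * (a ^ 2 / v) ^ 2)) ^ n := by
        refine mul_le_mul_of_nonneg_left (pow_le_pow_left₀ (integral_nonneg fun y => ?_)
          (integral_rpow_le hv hs hρ hρ1) n) (by positivity)
        have := Real.cosh_pos (t * y)
        positivity
    _ = _ := by
        rw [← Real.exp_nat_mul]; ring

end Chi

/-! ### Threshold decoding in white Gaussian noise -/

section Noise

variable {Ω : Type*} [MeasurableSpace Ω] {P : Measure Ω}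
  {B : L2 → Ω → ℝ} {N : ℝ}

lemma IsWGN.map_eq (hB : IsWGN P B N) (g : L2) :
    P.map (B g) = gaussianReal 0 (N / 2 * ∫ t, g t * g t).toNNReal := by
  have h := (hB.gaussian.hasGaussianLaw_eval g).map_eq_gaussianReal
  rw [h, hB.mean g, variance_of_integral_eq_zero (hB.measurable g).aemeasurable (hB.mean g),
    ← hB.cov g g]
  simp [sq]

lemma IsWGN.mgf_eq (hB : IsWGN P B N) (hN : 0 < N) (g : L2) (lam : ℝ) :
    mgf (B g) P lam = Real.exp (lam ^ 2 * (N / 2) * (∫ t, g t * g t) / 2) := by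
  have h0 : 0 ≤ N / 2 * ∫ t, g t * g t :=
    mul_nonneg (by linarith) (integral_nonneg fun t => mul_self_nonneg _)
  rw [mgf_gaussianReal (hB.map_eq g), Real.coe_toNNReal _ h0]
  congr 1; ring

lemma IsWGN.integrable_exp (hB : IsWGN P B N) (g : L2) (lam : ℝ) :
    Integrable (fun ω => Real.exp (lam * B g ω)) P := by
  have h := integrable_exp_mul_gaussianReal (μ := 0)
    (v := (N / 2 * ∫ t, g t * g t).toNNReal) lam
  rw [← hB.map_eq g] at h
  exact h.comp_measurable (hB.measurable g)

variable [IsProbabilityMeasure P]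

lemma IsWGN.prob_ge_le (hB : IsWGN P B N) (hN : 0 < N) (g : L2) {lam : ℝ} (hlam : 0 ≤ lam)
    (τ : ℝ) : P.real {ω | τ ≤ B g ω} ≤
      Real.exp (-lam * τ + lam ^ 2 * (N / 2) * (∫ t, g t * g t) / 2) := by
  have h := measure_ge_le_exp_mul_mgf τ hlam (hB.integrable_exp g lam)
  rwa [hB.mgf_eq hN, ← Real.exp_add] at h

lemma IsWGN.prob_le_neg_le (hB : IsWGN P B N) (hN : 0 < N) (g : L2) {lam : ℝ} (hlam : 0 ≤ lam)
    (τ : ℝ) : P.real {ω | B g ω ≤ -τ} ≤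
      Real.exp (-lam * τ + lam ^ 2 * (N / 2) * (∫ t, g t * g t) / 2) := by
  have h := measure_le_le_exp_mul_mgf (-τ) (neg_nonpos.mpr hlam) (hB.integrable_exp g (-lam))
  rw [hB.mgf_eq hN, ← Real.exp_add] at h
  convert h using 2
  ring

end Noise

open scoped Classical in
/-- The unique message that passes the test, or `0`. -/
def uniqueMessage {M : ℕ} (p : Fin M → Prop) : Fin (M + 1) :=
  if h : ∃! m, p m then h.choose.succ else 0

lemma uniqueMessage_eq_succ {M : ℕ} {p : Fin M → Prop} {m : Fin M} (hm : p m)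
    (h : ∀ m', m' ≠ m → ¬ p m') : uniqueMessage p = m.succ := by
  have hex : ∃! m, p m := ⟨m, hm, fun m' hm' => by by_contra hne; exact h m' hne hm'⟩
  rw [uniqueMessage, dif_pos hex, hex.unique hex.choose_spec.1 hm]

lemma uniqueMessage_eq_zero {M : ℕ} {p : Fin M → Prop} (h : ∀ m, ¬ p m) :
    uniqueMessage p = 0 := by
  rw [uniqueMessage, dif_neg]
  rintro ⟨m, hm, -⟩
  exact h m hm

namespace PAMCode

variable {T : ℝ} (C : PAMCode T)

/-- The decoder that returns the unique message whose correlation with the received signal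
reaches the threshold `τ`. -/
def thresholdDecoder (h : Fin C.M → Fin C.K → L2) (τ : ℝ) : C.Decoder where
  toFun s Y := uniqueMessage fun m => τ ≤ Y (h m s)
  measurable s := by
    have h1 : Measurable fun (Y : L2 → ℝ) (m : Fin C.M) => τ ≤ Y (h m s) :=
      measurable_pi_iff.mpr fun m => measurableSet_setOfPred.mp
        (measurableSet_le measurable_const (measurable_pi_apply _))
    exact (Measurable.of_discrete (f := uniqueMessage (M := C.M))).comp h1

lemma signal_memLp (m : Fin C.M) (s : Fin C.K) : MemLp (C.signal m s) 2 volume :=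
  memLp_finsetSum _ fun i _ => (C.carrier_memLp i).const_mul _

/-- The codewords as elements of `L²`. -/
def signalLp (m : Fin C.M) (s : Fin C.K) : L2 := (C.signal_memLp m s).toLp

lemma integral_signal_mul_signal (m m' : Fin C.M) (s s' : Fin C.K) :
    ∫ t, C.signal m s t * C.signal m' s' t = ∑ i, C.x m s i * C.x m' s' i := by
  have hint : ∀ i j, Integrable (fun t => C.carrier i t * C.carrier j t) := fun i j =>
    (C.carrier_memLp i).integrable_mul (C.carrier_memLp j)
  have h1 : ∀ t, C.signal m s t * C.signal m' s' t =
      ∑ i, ∑ j, C.x m s i * C.x m' s' j * (C.carrier i t * C.carrier j t) := by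
    intro t
    rw [signal, signal, Finset.sum_mul_sum]
    exact Finset.sum_congr rfl fun i _ => Finset.sum_congr rfl fun j _ => by ring
  simp_rw [h1]
  rw [integral_finsetSum _ fun i _ => integrable_finsetSum _ fun j _ => (hint i j).const_mul _]
  refine Finset.sum_congr rfl fun i _ => ?_
  rw [integral_finsetSum _ fun j _ => (hint i j).const_mul _]
  simp_rw [integral_const_mul, C.carrier_orthonormal]
  simp

lemma integral_signal_mul_signalLp (m m' : Fin C.M) (s s' : Fin C.K) :
    ∫ t, C.signal m s t * C.signalLp m' s' t = ∑ i, C.x m s i * C.x m' s' i := by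
  rw [← integral_signal_mul_signal]
  refine integral_congr_ae ?_
  filter_upwards [(C.signal_memLp m' s').coeFn_toLp] with t ht
  simp only [signalLp, ht]

lemma integral_signalLp_mul_self (m : Fin C.M) (s : Fin C.K) :
    ∫ t, C.signalLp m s t * C.signalLp m s t = ∑ i, C.x m s i * C.x m s i := by
  rw [← integral_signal_mul_signal]
  refine integral_congr_ae ?_
  filter_upwards [(C.signal_memLp m s).coeFn_toLp] with t ht
  simp only [signalLp, ht]

lemma perr_nonneg {Ω : Type*} [MeasurableSpace Ω] (P : Measure Ω) (B : L2 → Ω → ℝ)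
    (Γ : C.Decoder) : 0 ≤ Γ.perr P B := by
  unfold Decoder.perr
  refine add_nonneg (Real.iSup_nonneg fun s => ?_) ?_ <;> positivity

variable {Ω : Type*} [MeasurableSpace Ω] {P : Measure Ω} [IsProbabilityMeasure P]
  {B : L2 → Ω → ℝ} {N : ℝ}

/-- A union bound over a missed true codeword and false alarms of the others; in silence only false
alarms remain. -/
lemma perr_thresholdDecoder_le (hB : IsWGN P B N) (hN : 0 < N) {E η S : ℝ} (hη : 0 ≤ η)
    (hE : ∀ m s, ∑ i, C.x m s i * C.x m s i = E)
    (hS : ∀ m s, ∑ m' ∈ Finset.univ.erase m,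
      Real.exp ((∑ i, C.x m s i * C.x m' s i) / (N / 2)) ≤ S) :
    (C.thresholdDecoder C.signalLp ((1 - η) * E)).perr P B ≤
      Real.exp (-(η ^ 2 * E / N)) + Real.exp (-((1 - 2 * η) * E / N)) * (S + C.M) := by
  have hM : (0 : ℝ) < C.M := by exact_mod_cast C.M_pos
  have hK : (0 : ℝ) < C.K := by exact_mod_cast C.K_pos
  have : Nonempty (Fin C.K) := ⟨⟨0, C.K_pos⟩⟩
  set ε₁ := Real.exp (-(η ^ 2 * E / N)) with hε₁
  set ε₂ := Real.exp (-((1 - 2 * η) * E / N)) with hε₂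
  -- The tilt `2 / N` does not depend on the correlation `c`, so `c` enters through an exponential
  -- factor that is easy to average over random codes.
  have hfalse : ∀ m s c, P.real {ω | (1 - η) * E ≤ c + B (C.signalLp m s) ω} ≤
      ε₂ * Real.exp (c / (N / 2)) := by
    intro m s c
    have h := hB.prob_ge_le hN (C.signalLp m s) (lam := 2 / N) (by positivity) ((1 - η) * E - c)
    rw [C.integral_signalLp_mul_self, hE] at h
    simp_rw [sub_le_iff_le_add'] at h
    refine h.trans (le_of_eq ?_)
    rw [hε₂, ← Real.exp_add]
    congr 1
    field_simp; ring
  -- The tilt `2 η / N` minimizes the Chernoff exponent at deviation `η E`.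
  have hmiss : ∀ m s, P.real {ω | E + B (C.signalLp m s) ω < (1 - η) * E} ≤ ε₁ := by
    intro m s
    have h := hB.prob_le_neg_le hN (C.signalLp m s) (lam := 2 * η / N) (by positivity) (η * E)
    rw [C.integral_signalLp_mul_self, hE] at h
    refine (measureReal_mono fun ω hω => ?_).trans (h.trans (le_of_eq ?_))
    · simp only [Set.mem_ofPred_eq] at hω ⊢; linarith
    · rw [hε₁]
      congr 1
      field_simp; ring
  have hactive : ∀ m s, P.real {ω | (C.thresholdDecoder C.signalLp ((1 - η) * E)).toFun s
      (received B (C.signal m s) ω) ≠ m.succ} ≤ ε₁ + ε₂ * S := by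
    intro m s
    have hsub : {ω | (C.thresholdDecoder C.signalLp ((1 - η) * E)).toFun s
        (received B (C.signal m s) ω) ≠ m.succ} ⊆
        {ω | E + B (C.signalLp m s) ω < (1 - η) * E} ∪ ⋃ m' ∈ Finset.univ.erase m,
          {ω | (1 - η) * E ≤ (∑ i, C.x m s i * C.x m' s i) + B (C.signalLp m' s) ω} := by
      intro ω hω
      by_contra hcon
      simp only [Set.mem_union, Set.mem_iUnion, Set.mem_ofPred_eq, not_or, not_exists,
        Finset.mem_erase, Finset.mem_univ, and_true, not_lt, exists_prop, not_and] at hcon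
      refine hω (uniqueMessage_eq_succ ?_ fun m' hm' => ?_)
      · simp only [received, C.integral_signal_mul_signalLp, hE]
        exact hcon.1
      · simp only [received, C.integral_signal_mul_signalLp]
        exact hcon.2 m' hm'
    calc _ ≤ _ := measureReal_mono hsub
      _ ≤ ε₁ + ∑ m' ∈ Finset.univ.erase m,
          ε₂ * Real.exp ((∑ i, C.x m s i * C.x m' s i) / (N / 2)) := by
        refine (measureReal_union_le _ _).trans (add_le_add (hmiss m s) ?_)
        exact (measureReal_biUnion_finset_le _ _).trans
          (Finset.sum_le_sum fun m' _ => hfalse m' s _)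
      _ ≤ _ := by
        rw [← Finset.mul_sum]
        have := mul_le_mul_of_nonneg_left (hS m s) (Real.exp_pos (-((1 - 2 * η) * E / N))).le
        linarith
  have hsilent : ∀ s, P.real {ω | (C.thresholdDecoder C.signalLp ((1 - η) * E)).toFun s
      (received B 0 ω) ≠ 0} ≤ ε₂ * C.M := by
    intro s
    have hsub : {ω | (C.thresholdDecoder C.signalLp ((1 - η) * E)).toFun s
        (received B 0 ω) ≠ 0} ⊆ ⋃ m' ∈ (Finset.univ : Finset (Fin C.M)),
          {ω | (1 - η) * E ≤ 0 + B (C.signalLp m' s) ω} := by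
      intro ω hω
      by_contra hcon
      simp only [Set.mem_iUnion, Set.mem_ofPred_eq, not_exists, Finset.mem_univ,
        exists_prop, true_and] at hcon
      refine hω (uniqueMessage_eq_zero fun m' => ?_)
      simpa [received] using hcon m'
    refine (measureReal_mono hsub (measure_ne_top _ _)).trans ((measureReal_biUnion_finset_le _ _).trans ?_)
    refine (Finset.sum_le_sum fun m' _ => hfalse m' s 0).trans (le_of_eq ?_)
    simp; ring
  unfold Decoder.perr
  have h1 : (⨆ s : Fin C.K, (1 / (C.M : ℝ)) * ∑ m : Fin C.M,
      P.real {ω | (C.thresholdDecoder C.signalLp ((1 - η) * E)).toFun s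
        (received B (C.signal m s) ω) ≠ m.succ}) ≤ ε₁ + ε₂ * S := by
    refine ciSup_le fun s => ?_
    calc _ ≤ (1 / (C.M : ℝ)) * ∑ m : Fin C.M, (ε₁ + ε₂ * S) :=
          mul_le_mul_of_nonneg_left (Finset.sum_le_sum fun m _ => hactive m s) (by positivity)
      _ = _ := by simp; field_simp
  have h2 : (1 / (C.K : ℝ)) * ∑ s : Fin C.K,
      P.real {ω | (C.thresholdDecoder C.signalLp ((1 - η) * E)).toFun s
        (received B 0 ω) ≠ 0} ≤ ε₂ * C.M := by
    calc _ ≤ (1 / (C.K : ℝ)) * ∑ s : Fin C.K, (ε₂ * C.M) :=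
          mul_le_mul_of_nonneg_left (Finset.sum_le_sum fun s _ => hsilent s) (by positivity)
      _ = _ := by simp; field_simp
  linarith

end PAMCode

/-! ### Linear BPSK codes with root raised cosine pulses -/

section LinearCode

variable {T T₀ β a : ℝ} {k₁ k₂ : ℕ}

/-- An enumeration of binary strings. -/
def bits (k : ℕ) : Fin (2 ^ k) ≃ (Fin k → ZMod 2) :=
  (Fintype.equivFinOfCardEq (by simp)).symm

/-- The BPSK code whose codeword for message `m` and key `s` has the signs
`chi (m, s) (g i)`. -/
def linearCode (T : ℝ) (hT : 0 < T₀) (hβ : β ∈ Set.Icc (0 : ℝ) 1) (a : ℝ) (k₁ k₂ : ℕ)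
    (g : Fin ⌊T / T₀⌋₊ → (Fin k₁ ⊕ Fin k₂) → ZMod 2) : PAMCode T where
  n := ⌊T / T₀⌋₊
  M := 2 ^ k₁
  K := 2 ^ k₂
  M_pos := by positivity
  K_pos := by positivity
  carrier i t := rrc T₀ β (t - ((i : ℝ) + 1 / 2) * T₀)
  carrier_memLp i := rrc_shift_memLp hT hβ 2 _
  carrier_support i t ht := by
    refine rrc_eq_zero hT hβ ?_
    by_contra! h
    rw [abs_le] at h
    have hi : ((i : ℕ) : ℝ) + 1 ≤ T / T₀ := by
      have h1 : (i : ℕ) + 1 ≤ ⌊T / T₀⌋₊ := i.2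
      -- Since `i + 1` is nonzero, no sign assumption on `T` is needed. The bound says that the last
      -- pulse ends by time `T`.
      have h2 := (Nat.le_floor_iff' (by omega)).mp h1
      exact_mod_cast h2
    rw [le_div_iff₀ hT] at hi
    refine ht ⟨?_, ?_⟩
    · have : 0 ≤ ((i : ℕ) : ℝ) * T₀ := by positivity
      nlinarith
    · nlinarith
  carrier_orthonormal i j := by
    rw [rrc_shift_orthonormal hT hβ i j]
    simp [Fin.ext_iff]
  x m s i := a * chi (Sum.elim (bits k₁ m) (bits k₂ s)) (g i)

variable (hT : 0 < T₀) (hβ : β ∈ Set.Icc (0 : ℝ) 1)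
  (g : Fin ⌊T / T₀⌋₊ → (Fin k₁ ⊕ Fin k₂) → ZMod 2)

lemma sum_bits {E : Type*} [AddCommMonoid E] (f : ((Fin k₁ ⊕ Fin k₂) → ZMod 2) → E) :
    ∑ m, ∑ s, f (Sum.elim (bits k₁ m) (bits k₂ s)) = ∑ u, f u := by
  rw [(bits k₁).sum_comp (fun m => ∑ s, f (Sum.elim m (bits k₂ s)))]
  simp_rw [fun m => (bits k₂).sum_comp (fun s => f (Sum.elim m s))]
  rw [← Fintype.sum_prod_type', ← (Equiv.sumArrowEquivProdArrow _ _ _).symm.sum_comp]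
  rfl

lemma linearCode_isBPSKRRC (ha : 0 < a) : (linearCode T hT hβ a k₁ k₂ g).IsBPSKRRC :=
  ⟨T₀, β, a, hT, hβ, ha, rfl, fun _ _ => rfl, fun m s i => by
    rcases chi_eq_or (Sum.elim (bits k₁ m) (bits k₂ s)) (g i) with h | h <;>
      simp [linearCode, h]⟩

/-- Injectivity of `g` gives distinct, hence orthogonal, characters; `n > 0` keeps the spectrum
nonzero, as the strict mask inequalities require. -/
lemma linearCode_fits {S : SpectralMask} (hS : S.Feasible β T₀) (ha : 0 < a)
    (hn : 0 < ⌊T / T₀⌋₊) (hg : Function.Injective g) :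
    S.Fits (linearCode T hT hβ a k₁ k₂ g).codeESD := by
  have h : (linearCode T hT hβ a k₁ k₂ g).codeESD =
      fun f => (⌊T / T₀⌋₊ * a ^ 2) * esd (rrc T₀ β) f := by
    ext f
    refine (linearCode T hT hβ a k₁ k₂ g).codeESD_of_white hT hβ (fun _ _ => rfl) ?_ f
    intro i j
    have h1 : ∀ u : (Fin k₁ ⊕ Fin k₂) → ZMod 2, (a * chi u (g i)) * (a * chi u (g j)) =
        a ^ 2 * (chi u (g i) * chi u (g j)) := fun u => by ring
    change ∑ m, ∑ s, (a * chi (Sum.elim (bits k₁ m) (bits k₂ s)) (g i)) *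
      (a * chi (Sum.elim (bits k₁ m) (bits k₂ s)) (g j)) = _
    rw [sum_bits (fun u => (a * chi u (g i)) * (a * chi u (g j)))]
    simp_rw [h1]
    rw [← Finset.mul_sum, sum_chi_mul_chi]
    have h2 : ((Fintype.card ((Fin k₁ ⊕ Fin k₂) → ZMod 2) : ℕ) : ℝ) =
        (((2 ^ k₁ : ℕ) : ℝ)) * ((2 ^ k₂ : ℕ) : ℝ) := by
      simp [pow_add]
    by_cases hij : i = j
    · rw [if_pos (congrArg g hij), if_pos hij, h2]
      simp [linearCode]; ring
    · rw [if_neg fun h => hij (hg h), if_neg hij, mul_zero]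
  rw [h]
  have hn' : (0 : ℝ) < ⌊T / T₀⌋₊ := by exact_mod_cast hn
  exact hS.fits_const_mul hβ (by positivity)

lemma linearCode_kl {Nw : ℝ} (hNw : 0 < Nw) :
    (linearCode T hT hβ a k₁ k₂ g).kl Nw = ENNReal.ofReal
      (⌊T / T₀⌋₊ * bpskDiv a (Nw / 2).toNNReal +
        resolvability a (Nw / 2).toNNReal (fun u i => chi u (g i))) := by
  have hv : (Nw / 2).toNNReal ≠ 0 := by
    rw [Ne, Real.toNNReal_eq_zero]; linarith
  rw [← klDiv_mixDist hv (fun u i => chi_eq_or u (g i)) fun u u' i => chi_add_left u u' (g i)]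
  have h1 : (linearCode T hT hβ a k₁ k₂ g).activeDist Nw =
      mixDist a (Nw / 2).toNNReal (fun u i => chi u (g i)) := by
    unfold PAMCode.activeDist mixDist
    congr 1
    · simp [linearCode, pow_add]
    · exact sum_bits fun u => Measure.pi fun i => gaussianReal (a * chi u (g i)) (Nw / 2).toNNReal
  unfold PAMCode.kl
  rw [h1]
  rfl

/-- The sum, over the nonzero messages, of the exponential of the correlation with the
zero message. -/
def correlationSum {n : ℕ} (k₁ k₂ : ℕ) (c : ℝ) (g : Fin n → (Fin k₁ ⊕ Fin k₂) → ZMod 2) : ℝ :=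
  ∑ d ∈ (Finset.univ : Finset (Fin k₁ → ZMod 2)).erase 0,
    ∏ i, Real.exp (c * chi (Sum.elim d 0) (g i))

lemma correlationSum_nonneg {n : ℕ} (c : ℝ) (g : Fin n → (Fin k₁ ⊕ Fin k₂) → ZMod 2) :
    0 ≤ correlationSum k₁ k₂ c g :=
  Finset.sum_nonneg fun _ _ => Finset.prod_nonneg fun _ _ => (Real.exp_pos _).le

/-- Each nonzero message averages to `cosh c ^ n`, and `cosh c ≤ exp (c² / 2)`. -/
lemma sum_correlationSum_le {n : ℕ} (c : ℝ) :
    ∑ g : Fin n → (Fin k₁ ⊕ Fin k₂) → ZMod 2, correlationSum k₁ k₂ c g ≤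
      Fintype.card (Fin n → (Fin k₁ ⊕ Fin k₂) → ZMod 2) * (2 ^ k₁ * Real.exp (n * c ^ 2 / 2)) := by
  unfold correlationSum
  rw [Finset.sum_comm]
  have h : ∀ d ∈ (Finset.univ : Finset (Fin k₁ → ZMod 2)).erase 0,
      ∑ g : Fin n → (Fin k₁ ⊕ Fin k₂) → ZMod 2, ∏ i, Real.exp (c * chi (Sum.elim d 0) (g i)) ≤
      Fintype.card (Fin n → (Fin k₁ ⊕ Fin k₂) → ZMod 2) * Real.exp (n * c ^ 2 / 2) := by
    intro d hd
    have hd0 : (Sum.elim d 0 : (Fin k₁ ⊕ Fin k₂) → ZMod 2) ≠ 0 := by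
      intro h0
      exact Finset.ne_of_mem_erase hd (funext fun j => congrFun h0 (Sum.inl j))
    rw [sum_prod_chi hd0 fun _ x => Real.exp (c * x)]
    refine mul_le_mul_of_nonneg_left ?_ (by positivity)
    have : (Real.exp (c * 1) + Real.exp (c * -1)) / 2 = Real.cosh c := by
      rw [Real.cosh_eq]; simp
    simp only [this, Finset.prod_const, Finset.card_univ, Fintype.card_fin]
    refine (pow_le_pow_left₀ (Real.cosh_pos c).le (Real.cosh_le_exp_half_sq c) n).trans_eq ?_
    rw [← Real.exp_nat_mul]; congr 1; ring
  refine (Finset.sum_le_sum h).trans ?_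
  rw [Finset.sum_const, nsmul_eq_mul]
  have hcard : ((((Finset.univ : Finset (Fin k₁ → ZMod 2)).erase 0).card : ℕ) : ℝ) ≤ 2 ^ k₁ := by
    have := Finset.card_le_card (Finset.erase_subset (0 : Fin k₁ → ZMod 2) Finset.univ)
    rw [Finset.card_univ] at this
    simp only [Fintype.card_pi, ZMod.card, Finset.prod_const, Finset.card_univ,
      Fintype.card_fin] at this
    exact_mod_cast this
  calc _ ≤ 2 ^ k₁ * (Fintype.card (Fin n → (Fin k₁ ⊕ Fin k₂) → ZMod 2) *
        Real.exp (n * c ^ 2 / 2)) := mul_le_mul_of_nonneg_right hcard (by positivity)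
    _ = _ := by ring

/-- For a common key, the coordinatewise product of two sign patterns is the pattern of the message
sum with key zero. One correlation sum therefore controls every message and every key, and the
maximum over keys costs nothing. -/
lemma linearCode_perr_le {Ω : Type*} [MeasurableSpace Ω] {P : Measure Ω} [IsProbabilityMeasure P]
    {B : L2 → Ω → ℝ} {N : ℝ} (hB : IsWGN P B N) (hN : 0 < N) {η : ℝ} (hη : 0 ≤ η) :
    ∃ Γ : (linearCode T hT hβ a k₁ k₂ g).Decoder, Γ.perr P B ≤
      Real.exp (-(η ^ 2 * (⌊T / T₀⌋₊ * a ^ 2) / N)) +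
        Real.exp (-((1 - 2 * η) * (⌊T / T₀⌋₊ * a ^ 2) / N)) *
          (correlationSum k₁ k₂ (a ^ 2 / (N / 2)) g + 2 ^ k₁) := by
  set C := linearCode T hT hβ a k₁ k₂ g with hC
  refine ⟨C.thresholdDecoder C.signalLp ((1 - η) * (⌊T / T₀⌋₊ * a ^ 2)), ?_⟩
  have hx : ∀ (m m' : Fin (2 ^ k₁)) (s : Fin (2 ^ k₂)),
      ∑ i, (a * chi (Sum.elim (bits k₁ m) (bits k₂ s)) (g i)) *
        (a * chi (Sum.elim (bits k₁ m') (bits k₂ s)) (g i)) =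
      a ^ 2 * ∑ i, chi (Sum.elim (bits k₁ m + bits k₁ m') 0) (g i) := by
    intro m m' s
    have h0 : (Sum.elim (bits k₁ m + bits k₁ m') 0 : (Fin k₁ ⊕ Fin k₂) → ZMod 2) =
        Sum.elim (bits k₁ m) (bits k₂ s) + Sum.elim (bits k₁ m') (bits k₂ s) := by
      ext j
      rcases j with j | j
      · simp
      · have : ∀ x : ZMod 2, 0 = x + x := by decide
        simpa using this _
    rw [h0, Finset.mul_sum]
    refine Finset.sum_congr rfl fun i _ => ?_
    rw [chi_add_left]
    ring
  have hbij : ∀ m m' : Fin (2 ^ k₁), bits k₁ m + bits k₁ m' = 0 ↔ m' = m := by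
    intro m m'
    rw [add_eq_zero_iff_eq, (bits k₁).apply_eq_iff_eq]
    exact eq_comm
  have h := C.perr_thresholdDecoder_le hB hN (E := ⌊T / T₀⌋₊ * a ^ 2) (η := η)
    (S := correlationSum k₁ k₂ (a ^ 2 / (N / 2)) g) hη ?_ ?_
  · simpa [hC, linearCode] using h
  · intro (m : Fin (2 ^ k₁)) (s : Fin (2 ^ k₂))
    refine (hx m m s).trans ?_
    rw [(hbij m m).mpr rfl]
    have : (Sum.elim 0 0 : (Fin k₁ ⊕ Fin k₂) → ZMod 2) = 0 := by ext j; rcases j <;> rfl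
    rw [this]
    simp only [chi_zero_left, Finset.sum_const, Finset.card_univ, Fintype.card_fin, nsmul_eq_mul,
      mul_one]
    exact mul_comm _ _
  · intro (m : Fin (2 ^ k₁)) (s : Fin (2 ^ k₂))
    change ∑ m' ∈ (Finset.univ : Finset (Fin (2 ^ k₁))).erase m,
      Real.exp ((∑ i, (a * chi (Sum.elim (bits k₁ m) (bits k₂ s)) (g i)) *
        (a * chi (Sum.elim (bits k₁ m') (bits k₂ s)) (g i))) / (N / 2)) ≤ _
    refine le_of_eq ?_
    unfold correlationSum
    -- Adding `m` maps the competing messages bijectively onto the nonzero ones.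
    refine Finset.sum_bij (fun m' _ => bits k₁ m + bits k₁ m') ?_ ?_ ?_ ?_
    · intro m' hm'
      rw [Finset.mem_erase] at hm' ⊢
      exact ⟨fun h => hm'.1 ((hbij m m').mp h), Finset.mem_univ _⟩
    · intro m₁ _ m₂ _ h
      exact (bits k₁).injective (add_left_cancel h)
    · intro d hd
      refine ⟨(bits k₁).symm (d - bits k₁ m), ?_, ?_⟩
      · rw [Finset.mem_erase] at hd ⊢
        refine ⟨fun h => hd.1 ?_, Finset.mem_univ _⟩
        rw [← (hbij m _).mpr h]
        simp
      · simp
    · intro m' _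
      rw [hx, ← Real.exp_sum, ← Finset.mul_sum]
      congr 1
      ring

end LinearCode

/-! ### Existence of good linear codes -/

section Existence

/-- First-moment method: the resolvability, the weighted correlation sum and the number of
collisions are nonnegative, so some `g` has all three below the bound on their average sum. -/
lemma exists_signs {n k₁ k₂ : ℕ} {a : ℝ} {v : ℝ≥0} (hv : v ≠ 0) (hs : a ^ 2 / v ≤ 1 / 8) {ρ : ℝ}
    (hρ : 0 < ρ) (hρ1 : ρ ≤ 1) {c w κ : ℝ} (hw : 0 ≤ w) (hκ : κ ≤ 1)
    (h : 1 / ρ * (Real.exp (n * (ρ * (1 + ρ) / 2 * (a ^ 2 / v) + 500 * (a ^ 2 / v) ^ 2)) /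
        ((2 : ℝ) ^ (k₁ + k₂)) ^ ρ) + w * (2 ^ k₁ * Real.exp (n * c ^ 2 / 2)) +
        (n : ℝ) ^ 2 / 2 ^ (k₁ + k₂) < κ) :
    ∃ g : Fin n → (Fin k₁ ⊕ Fin k₂) → ZMod 2, Function.Injective g ∧
      resolvability a v (fun u i => chi u (g i)) ≤ κ ∧ w * correlationSum k₁ k₂ c g ≤ κ := by
  have hcard : ((Fintype.card ((Fin k₁ ⊕ Fin k₂) → ZMod 2) : ℕ) : ℝ) = 2 ^ (k₁ + k₂) := by
    simp [pow_add]
  set N : ℝ := ((Fintype.card (Fin n → (Fin k₁ ⊕ Fin k₂) → ZMod 2) : ℕ) : ℝ) with hN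
  have hN0 : 0 < N := by rw [hN]; exact_mod_cast Fintype.card_pos
  set coll : (Fin n → (Fin k₁ ⊕ Fin k₂) → ZMod 2) → ℝ := fun g =>
    ∑ p ∈ (Finset.univ : Finset (Fin n)).offDiag, if g p.1 = g p.2 then (1 : ℝ) else 0 with hcoll
  have hcoll0 : ∀ g, 0 ≤ coll g := fun g =>
    Finset.sum_nonneg fun p _ => by split_ifs <;> norm_num
  have hcollsum : ∑ g, coll g ≤ N * ((n : ℝ) ^ 2 / 2 ^ (k₁ + k₂)) := by
    simp only [hcoll]
    rw [Finset.sum_comm, Finset.sum_congr rfl fun p hp =>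
      sum_collision (ι := Fin k₁ ⊕ Fin k₂) (Finset.mem_offDiag.mp hp).2.2, Finset.sum_const,
      nsmul_eq_mul, hcard, ← hN]
    have : (((Finset.univ : Finset (Fin n)).offDiag.card : ℕ) : ℝ) ≤ (n : ℝ) ^ 2 := by
      rw [Finset.offDiag_card, Finset.card_univ, Fintype.card_fin, sq]
      exact_mod_cast Nat.sub_le _ _
    calc _ ≤ (n : ℝ) ^ 2 * (N / 2 ^ (k₁ + k₂)) := mul_le_mul_of_nonneg_right this (by positivity)
      _ = _ := by ring
  have hres := sum_resolvability_le (ι := Fin k₁ ⊕ Fin k₂) (n := n) hv hs hρ hρ1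
  rw [← hN, hcard] at hres
  have hcor := mul_le_mul_of_nonneg_left (sum_correlationSum_le (n := n) (k₁ := k₁) (k₂ := k₂) c) hw
  rw [← hN] at hcor
  have hres0 : ∀ g : Fin n → (Fin k₁ ⊕ Fin k₂) → ZMod 2, 0 ≤ resolvability a v (fun u i => chi u (g i)) := fun g =>
    resolvability_nonneg hv (fun u i => chi_eq_or u (g i)) fun u u' i => chi_add_left u u' (g i)
  have hcor0 : ∀ g : Fin n → (Fin k₁ ⊕ Fin k₂) → ZMod 2, 0 ≤ w * correlationSum k₁ k₂ c g := fun g =>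
    mul_nonneg hw (correlationSum_nonneg c g)
  obtain ⟨g, -, hg⟩ := Finset.exists_lt_of_sum_lt (s := (Finset.univ : Finset (Fin n → (Fin k₁ ⊕ Fin k₂) → ZMod 2)))
    (f := fun g => resolvability a v (fun u i => chi u (g i)) + w * correlationSum k₁ k₂ c g +
      coll g) (g := fun _ => κ) (by
    rw [Finset.sum_add_distrib, Finset.sum_add_distrib, ← Finset.mul_sum, Finset.sum_const,
      Finset.card_univ, nsmul_eq_mul, ← hN]
    refine lt_of_le_of_lt (add_le_add (add_le_add hres hcor) hcollsum) ?_
    have := mul_lt_mul_of_pos_left h hN0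
    linarith)
  refine ⟨g, fun i j hij => ?_, ?_, ?_⟩
  -- A collision would contribute at least `1 ≥ κ` to the sum.
  · by_contra hne
    have h1 : (1 : ℝ) ≤ coll g := by
      have := Finset.single_le_sum (f := fun p : Fin n × Fin n =>
        if g p.1 = g p.2 then (1 : ℝ) else 0) (a := (i, j)) (fun p _ => by split_ifs <;> norm_num)
        (Finset.mem_offDiag.mpr ⟨Finset.mem_univ i, Finset.mem_univ j, hne⟩)
      rw [if_pos hij] at this
      exact this
    linarith [hres0 g, hcor0 g]
  · linarith [hcor0 g, hcoll0 g]
  · linarith [hres0 g, hcoll0 g]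

lemma eventually_exp_le {c d κ : ℝ} (hc : 0 < c) (hκ : 0 < κ) :
    ∀ᶠ x : ℝ in atTop, Real.exp (d - c * x) ≤ κ := by
  have h : Tendsto (fun x : ℝ => Real.exp (d - c * x)) atTop (𝓝 0) := by
    refine Real.tendsto_exp_atBot.comp ?_
    exact tendsto_atBot_add_const_left _ _
      (tendsto_neg_atTop_atBot.comp (tendsto_id.const_mul_atTop hc))
  exact (h.eventually (ge_mem_nhds hκ))

set_option maxHeartbeats 1000000 in
lemma eventually_exists_signs {δ Nw Nb η κ : ℝ} (hδ : δ ∈ Set.Ioo (0 : ℝ) 1) (hNw : 0 < Nw)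
    (hNb : 0 < Nb) (hη : 0 < η) (hη1 : η ≤ 1 / 16) (hκ : 0 < κ) :
    ∀ᶠ n : ℕ in atTop, ∃ (k₁ k₂ : ℕ) (a : ℝ), 0 < a ∧
      (1 - 5 * η) * (Nw / Nb) * Real.sqrt (δ * n) - Real.log 2 ≤ k₁ * Real.log 2 ∧
      k₂ * Real.log 2 ≤ (max (1 - Nw / Nb) 0 + (9 + 5 * (Nw / Nb)) * η) * Real.sqrt (δ * n) +
        Real.log 2 ∧
      ∃ g : Fin n → (Fin k₁ ⊕ Fin k₂) → ZMod 2, Function.Injective g ∧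
        (1 - η) ^ 2 * δ - κ ≤ n * bpskDiv a (Nw / 2).toNNReal +
          resolvability a (Nw / 2).toNNReal (fun u i => chi u (g i)) ∧
        n * bpskDiv a (Nw / 2).toNNReal +
          resolvability a (Nw / 2).toNNReal (fun u i => chi u (g i)) ≤ (1 - η) ^ 2 * δ + κ ∧
        Real.exp (-(η ^ 2 * (n * a ^ 2) / Nb)) + Real.exp (-((1 - 2 * η) * (n * a ^ 2) / Nb)) *
          (correlationSum k₁ k₂ (a ^ 2 / (Nb / 2)) g + 2 ^ k₁) ≤ κ := by
  obtain ⟨hδ0, hδ1⟩ := hδ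
  set b := Nw / Nb with hb
  have hb0 : 0 < b := by positivity
  -- The cap at `1` is what `exists_signs` needs to exclude collisions.
  set κ' := min κ 1 with hκ'
  have hκ'0 : 0 < κ' := lt_min hκ one_pos
  have hκ'1 : κ' ≤ 1 := min_le_right _ _
  have hκ'κ : κ' ≤ κ := min_le_left _ _
  set θ := 1 - η with hθ
  have hθ0 : 0 < θ := by linarith
  have hθ1 : θ ≤ 1 := by linarith
  have hlog2 : 0 < Real.log 2 := Real.log_pos one_lt_two
  have hx : Tendsto (fun n : ℕ => Real.sqrt (δ * n)) atTop atTop :=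
    Real.tendsto_sqrt_atTop.comp (tendsto_natCast_atTop_atTop.const_mul_atTop hδ0)
  have hpow : ∀ᶠ x : ℝ in atTop, x ^ 4 * Real.exp (-x) ≤ δ ^ 2 * (κ' / 8) :=
    (Real.tendsto_pow_mul_exp_neg_atTop_nhds_zero 4).eventually (ge_mem_nhds (by positivity))
  have hev : ∀ᶠ x : ℝ in atTop, 16 ≤ x ∧ Real.log 2 / (7 * η) ≤ x ∧ 12800 / κ' ≤ x ∧
      Real.exp (2000 - (η ^ 2 * θ) * x) ≤ η * (κ' / 8) ∧
      Real.exp (2 * b ^ 2 - (2 * η * θ * b) * x) ≤ κ' / 8 ∧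
      Real.exp (0 - (η ^ 2 * θ * b) * x) ≤ κ' / 8 ∧
      x ^ 4 * Real.exp (-x) ≤ δ ^ 2 * (κ' / 8) := by
    filter_upwards [eventually_ge_atTop 16, eventually_ge_atTop (Real.log 2 / (7 * η)),
      eventually_ge_atTop (12800 / κ'),
      eventually_exp_le (c := η ^ 2 * θ) (d := 2000) (κ := η * (κ' / 8)) (by positivity)
        (by positivity),
      eventually_exp_le (c := 2 * η * θ * b) (d := 2 * b ^ 2) (κ := κ' / 8) (by positivity)
        (by positivity),
      eventually_exp_le (c := η ^ 2 * θ * b) (d := 0) (κ := κ' / 8) (by positivity)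
        (by positivity), hpow] with x h1 h2 h3 h4 h5 h6 h7
    exact ⟨h1, h2, h3, h4, h5, h6, h7⟩
  filter_upwards [hx.eventually hev, eventually_gt_atTop 0] with n hn hn0
  have hn0' : (0 : ℝ) < n := by exact_mod_cast hn0
  set x := Real.sqrt (δ * n) with hxdef
  have hx2 : x ^ 2 = δ * n := Real.sq_sqrt (by positivity)
  obtain ⟨h16, hlog, h128, he1, he2, he3, he4⟩ := hn
  have hx0 : 0 < x := by linarith
  have ha0 : 0 < θ * Nw * x / n := by positivity
  -- This amplitude makes `n s² / 4 = θ² δ`, the divergence to leading order, and `n a² / Nb = θ b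
  -- x`.
  set a := Real.sqrt (θ * Nw * x / n) with ha
  have ha2 : a ^ 2 = θ * Nw * x / n := Real.sq_sqrt ha0.le
  have hNv : (((Nw / 2).toNNReal : ℝ≥0) : ℝ) = Nw / 2 := Real.coe_toNNReal _ (by linarith)
  have hv : (Nw / 2).toNNReal ≠ 0 := by rw [Ne, Real.toNNReal_eq_zero]; linarith
  set v := (Nw / 2).toNNReal with hvdef
  set s := a ^ 2 / v with hsdef
  have hs : s = 2 * θ * x / n := by rw [hsdef, ha2, hNv]; field_simp
  have hns : n * s = 2 * θ * x := by rw [hs]; field_simp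
  have hsx : s * x = 2 * θ * δ := by
    rw [hs, div_mul_eq_mul_div, mul_assoc, ← sq, hx2]; field_simp
  have hns2 : n * s ^ 2 = 4 * θ ^ 2 * δ := by
    calc n * s ^ 2 = (n * s) * s := by ring
      _ = 2 * θ * (s * x) := by rw [hns]; ring
      _ = _ := by rw [hsx]; ring
  have hs0 : 0 < s := by rw [hs]; positivity
  have hθδ : θ * δ ≤ 1 := mul_le_one₀ hθ1 hδ0.le hδ1.le
  have hθδ2 : θ ^ 2 * δ ≤ 1 := mul_le_one₀ (pow_le_one₀ hθ0.le hθ1) hδ0.le hδ1.le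
  have hs8 : s ≤ 1 / 8 := by
    have := mul_le_mul_of_nonneg_left h16 hs0.le
    linarith
  have hns3 : 200 * (n * s ^ 3) ≤ κ' / 8 := by
    have h1 : n * s ^ 3 ≤ 4 * s := by
      calc n * s ^ 3 = (n * s ^ 2) * s := by ring
        _ = 4 * (θ ^ 2 * δ) * s := by rw [hns2]; ring
        _ ≤ 4 * s := by linarith [mul_le_mul_of_nonneg_right hθδ2 hs0.le]
    have h2 : 12800 ≤ x * κ' := by rwa [div_le_iff₀ hκ'0] at h128
    have h3 : s * x ≤ 2 := by linarith
    have h4 : s * 12800 ≤ 2 * κ' := by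
      calc s * 12800 ≤ s * (x * κ') := mul_le_mul_of_nonneg_left h2 hs0.le
        _ = (s * x) * κ' := by ring
        _ ≤ 2 * κ' := mul_le_mul_of_nonneg_right h3 hκ'0.le
    linarith
  have hE : n * a ^ 2 / Nb = θ * b * x := by rw [ha2, hb]; field_simp
  -- The message exponent lies `2 η θ b x` below the decoding exponent `(1 - 2 η) θ b x`. In the key
  -- length below, `5 b η` compensates for the reduced message rate, and `9 η` covers the excess `2
  -- η` in `hk12` plus `7 η` for rounding.
  set k₁ := ⌊(1 - 4 * η) * θ * b * x / Real.log 2⌋₊ with hk₁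
  set k₂ := ⌈(max (1 - b) 0 + (9 + 5 * b) * η) * x / Real.log 2⌉₊ with hk₂
  have h4η : 0 ≤ 1 - 4 * η := by linarith
  have hk₁u : k₁ * Real.log 2 ≤ (1 - 4 * η) * θ * b * x := by
    rw [← le_div_iff₀ hlog2]
    exact Nat.floor_le (by positivity)
  have hk₁l : (1 - 4 * η) * θ * b * x - Real.log 2 ≤ k₁ * Real.log 2 := by
    have := (Nat.lt_floor_add_one ((1 - 4 * η) * θ * b * x / Real.log 2)).le
    rw [div_le_iff₀ hlog2] at this
    linarith
  have hk₂l : (max (1 - b) 0 + (9 + 5 * b) * η) * x ≤ k₂ * Real.log 2 := by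
    rw [← div_le_iff₀ hlog2]
    exact Nat.le_ceil _
  have hm0 : 0 ≤ max (1 - b) 0 := le_max_right _ _
  have hk₂u : k₂ * Real.log 2 ≤ (max (1 - b) 0 + (9 + 5 * b) * η) * x + Real.log 2 := by
    have := (Nat.ceil_lt_add_one (a := (max (1 - b) 0 + (9 + 5 * b) * η) * x / Real.log 2)
      (by positivity)).le
    rw [← sub_le_iff_le_add, le_div_iff₀ hlog2] at this
    linarith
  have hbx : 0 ≤ η ^ 2 * (b * x) := by positivity
  have hk₁l' : (1 - 5 * η) * b * x - Real.log 2 ≤ k₁ * Real.log 2 := by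
    have : (1 - 4 * η) * θ * b * x = (1 - 5 * η) * b * x + 4 * (η ^ 2 * (b * x)) := by
      rw [hθ]; ring
    linarith
  have hk12 : (1 + 2 * η) * x ≤ (k₁ + k₂) * Real.log 2 := by
    have h1 : Real.log 2 ≤ 7 * η * x := by
      rw [div_le_iff₀ (by positivity)] at hlog; linarith
    have h2 : (1 - b) * x ≤ max (1 - b) 0 * x :=
      mul_le_mul_of_nonneg_right (le_max_left _ _) hx0.le
    linarith
  have hexp2 : ∀ k : ℕ, (2 : ℝ) ^ k = Real.exp (k * Real.log 2) := by
    intro k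
    rw [Real.exp_nat_mul, Real.exp_log two_pos]
  have hL : Real.exp ((1 + 2 * η) * x) ≤ (2 : ℝ) ^ (k₁ + k₂) := by
    rw [hexp2, Real.exp_le_exp]
    push_cast
    exact hk12
  set w := Real.exp (-((1 - 2 * η) * (n * a ^ 2) / Nb)) with hw
  have hweq : w = Real.exp (-((1 - 2 * η) * (θ * b * x))) := by
    rw [hw, mul_div_assoc, hE]
  have hM : (2 : ℝ) ^ k₁ ≤ Real.exp ((1 - 4 * η) * θ * b * x) := by
    rw [hexp2, Real.exp_le_exp]; exact hk₁u
  set c := a ^ 2 / (Nb / 2) with hc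
  have hnc2 : n * c ^ 2 / 2 ≤ 2 * b ^ 2 := by
    have h1 : c = b * s := by rw [hc, hsdef, hNv, hb]; field_simp
    have h2 : n * c ^ 2 / 2 = 2 * b ^ 2 * (θ ^ 2 * δ) := by
      calc n * c ^ 2 / 2 = b ^ 2 * (n * s ^ 2) / 2 := by rw [h1]; ring
        _ = _ := by rw [hns2]; ring
    rw [h2]
    linarith [mul_le_mul_of_nonneg_left hθδ2 (by positivity : 0 ≤ 2 * b ^ 2)]
  -- Here `ρ = η`: the code exponent `η (1 + 2 η) x` beats the moment exponent `η (1 + η) θ x` by at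
  -- least `η² θ x`, up to the constant `2000 = 500 * 4`.
  have hr1 : 1 / η * (Real.exp (n * (η * (1 + η) / 2 * s + 500 * s ^ 2)) /
      ((2 : ℝ) ^ (k₁ + k₂)) ^ η) ≤ κ' / 8 := by
    have h1 : Real.exp (η * ((1 + 2 * η) * x)) ≤ ((2 : ℝ) ^ (k₁ + k₂)) ^ η := by
      rw [mul_comm, Real.exp_mul]
      exact Real.rpow_le_rpow (Real.exp_pos _).le hL hη.le
    have h2 : n * (η * (1 + η) / 2 * s + 500 * s ^ 2) ≤
        η * (1 + η) * (θ * x) + 2000 := by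
      calc n * (η * (1 + η) / 2 * s + 500 * s ^ 2)
          = η * (1 + η) / 2 * (n * s) + 500 * (n * s ^ 2) := by ring
        _ = η * (1 + η) * (θ * x) + 2000 * (θ ^ 2 * δ) := by rw [hns, hns2]; ring
        _ ≤ _ := by linarith
    have h3 : Real.exp (n * (η * (1 + η) / 2 * s + 500 * s ^ 2)) /
        ((2 : ℝ) ^ (k₁ + k₂)) ^ η ≤ Real.exp (2000 - (η ^ 2 * θ) * x) := by
      rw [div_le_iff₀ (by positivity)]
      calc _ ≤ Real.exp (2000 - (η ^ 2 * θ) * x) * Real.exp (η * ((1 + 2 * η) * x)) := by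
            rw [← Real.exp_add, Real.exp_le_exp]
            refine h2.trans ?_
            have h5 : η * (1 + 2 * η) * (θ * x) ≤ η * (1 + 2 * η) * x := by
              exact mul_le_mul_of_nonneg_left (mul_le_of_le_one_left hx0.le hθ1) (by positivity)
            linarith
        _ ≤ _ := mul_le_mul_of_nonneg_left h1 (Real.exp_pos _).le
    calc _ ≤ 1 / η * (η * (κ' / 8)) := mul_le_mul_of_nonneg_left (h3.trans he1) (by positivity)
      _ = _ := by field_simp
  have hwM : w * 2 ^ k₁ ≤ Real.exp (-(2 * η * θ * b * x)) := by
    calc w * 2 ^ k₁ ≤ w * Real.exp ((1 - 4 * η) * θ * b * x) :=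
          mul_le_mul_of_nonneg_left hM (Real.exp_pos _).le
      _ = _ := by
          rw [hweq, ← Real.exp_add]; congr 1; ring
  have hr2 : w * (2 ^ k₁ * Real.exp (n * c ^ 2 / 2)) ≤ κ' / 8 := by
    refine le_trans ?_ he2
    calc w * (2 ^ k₁ * Real.exp (n * c ^ 2 / 2)) = (w * 2 ^ k₁) * Real.exp (n * c ^ 2 / 2) := by ring
      _ ≤ Real.exp (-(2 * η * θ * b * x)) * Real.exp (2 * b ^ 2) :=
          mul_le_mul hwM (Real.exp_le_exp.mpr hnc2) (Real.exp_pos _).le (Real.exp_pos _).le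
      _ = _ := by rw [← Real.exp_add]; congr 1; ring
  have hwM' : w * 2 ^ k₁ ≤ κ' / 8 := by
    refine hwM.trans (le_trans ?_ he2)
    rw [Real.exp_le_exp]; linarith [sq_nonneg b]
  have hr3 : (n : ℝ) ^ 2 / 2 ^ (k₁ + k₂) ≤ κ' / 8 := by
    have h1 : Real.exp x ≤ (2 : ℝ) ^ (k₁ + k₂) :=
      (Real.exp_le_exp.mpr (by linarith [mul_pos hη hx0])).trans hL
    have h2 : δ ^ 2 * (n : ℝ) ^ 2 = x ^ 4 := by
      calc δ ^ 2 * (n : ℝ) ^ 2 = (δ * n) ^ 2 := by ring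
        _ = _ := by rw [← hx2]; ring
    have h3 : (n : ℝ) ^ 2 / 2 ^ (k₁ + k₂) ≤ (n : ℝ) ^ 2 * Real.exp (-x) := by
      rw [Real.exp_neg, ← div_eq_mul_inv]
      exact div_le_div_of_nonneg_left (by positivity) (Real.exp_pos _) h1
    refine h3.trans ?_
    refine le_of_mul_le_mul_left ?_ (by positivity : 0 < δ ^ 2)
    rw [← mul_assoc, h2]
    exact he4
  obtain ⟨g, hinj, hres, hcor⟩ := exists_signs (n := n) (k₁ := k₁) (k₂ := k₂) (a := a) hv hs8 hη
    (by linarith) (c := c) (w := w) (κ := κ' / 2) (Real.exp_pos _).le (by linarith) (by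
      rw [← hsdef]; linarith)
  refine ⟨k₁, k₂, a, Real.sqrt_pos.mpr ha0, hk₁l', hk₂u, g, hinj, ?_, ?_, ?_⟩
  · have hr0 := resolvability_nonneg (a := a) hv (fun u i => chi_eq_or u (g i))
      fun u u' i => chi_add_left u u' (g i)
    have hd := (abs_le.mp (abs_bpskDiv_sub_le hv hs8)).1
    rw [← hsdef] at hd
    have := mul_le_mul_of_nonneg_left hd hn0'.le
    linarith
  · have hd := (abs_le.mp (abs_bpskDiv_sub_le hv hs8)).2
    rw [← hsdef] at hd
    have := mul_le_mul_of_nonneg_left hd hn0'.le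
    linarith
  · have h1 : Real.exp (-(η ^ 2 * (n * a ^ 2) / Nb)) ≤ κ' / 8 := by
      refine le_trans (le_of_eq ?_) he3
      rw [mul_div_assoc, hE]; congr 1; ring
    rw [← hw, ← hc, mul_add]
    linarith

end Existence

/-! ### Codes for every duration -/

section Main

/-- A code and a decoder that miss the optimal performance by at most `ε`. -/
structure NearOptimal (S : SpectralMask) {Ω : Type*} [MeasurableSpace Ω] (P : Measure Ω)
    (B : L2 → Ω → ℝ) (Nw δ r rK ε T : ℝ) (C : PAMCode T) (Γ : C.Decoder) : Prop where
  bpsk : C.IsBPSKRRC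
  fits : S.Fits C.codeESD
  kl_le : C.kl Nw ≤ ENNReal.ofReal δ
  le_kl : ENNReal.ofReal (δ - ε) ≤ C.kl Nw
  rate : r - ε ≤ Real.log (C.M : ℝ) / Real.sqrt T
  keyRate : Real.log (C.K : ℝ) / Real.sqrt T ≤ rK + ε
  perr_le : Γ.perr P B ≤ ε

/-- The infimum defining `minC` need not be attained, so a nearly optimal pulse is used. -/
lemma SpectralMask.exists_feasible_lt {S : SpectralMask}
    (hfeas : ∃ β ∈ Set.Icc (0 : ℝ) 1, ∃ T₀ : ℝ, S.Feasible β T₀) {ε : ℝ} (hε : 0 < ε) :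
    ∃ β ∈ Set.Icc (0 : ℝ) 1, ∃ T₀ : ℝ, S.Feasible β T₀ ∧ S.minC.toReal ≤ S.W * T₀ ∧
      S.W * T₀ < S.minC.toReal + ε := by
  have hle : ∀ β ∈ Set.Icc (0 : ℝ) 1, ∀ T₀ : ℝ, S.Feasible β T₀ →
      S.minC ≤ ENNReal.ofReal (S.W * T₀) := by
    intro β hβ T₀ h
    calc S.minC ≤ S.c β := iInf₂_le β hβ
      _ ≤ ENNReal.ofReal S.W * ENNReal.ofReal T₀ := mul_le_mul_right (iInf₂_le T₀ h) _
      _ = _ := (ENNReal.ofReal_mul S.W_pos.le).symm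
  have htop : S.minC ≠ ∞ := by
    obtain ⟨β, hβ, T₀, h⟩ := hfeas
    exact ne_top_of_le_ne_top ENNReal.ofReal_ne_top (hle β hβ T₀ h)
  have hlt : S.minC < ENNReal.ofReal (S.minC.toReal + ε) := by
    rw [ENNReal.lt_ofReal_iff_toReal_lt htop]; linarith
  obtain ⟨β, hβ, hc⟩ : ∃ β ∈ Set.Icc (0 : ℝ) 1, S.c β < ENNReal.ofReal (S.minC.toReal + ε) := by
    simpa [SpectralMask.minC, iInf_lt_iff] using hlt
  have hW : 0 < S.W := S.W_pos
  have hW0 : ENNReal.ofReal S.W ≠ 0 := by simpa using hW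
  have hc' : S.optDuration β < ENNReal.ofReal (S.minC.toReal + ε) / ENNReal.ofReal S.W := by
    rw [ENNReal.lt_div_iff_mul_lt (Or.inl hW0) (Or.inl ENNReal.ofReal_ne_top), mul_comm]
    exact hc
  obtain ⟨T₀, hT₀, hlt'⟩ : ∃ T₀ : ℝ, S.Feasible β T₀ ∧ ENNReal.ofReal T₀ <
      ENNReal.ofReal (S.minC.toReal + ε) / ENNReal.ofReal S.W := by
    simpa [SpectralMask.optDuration, iInf_lt_iff] using hc'
  refine ⟨β, hβ, T₀, hT₀, ?_, ?_⟩
  · exact ENNReal.toReal_le_of_le_ofReal (mul_nonneg hW.le hT₀.1.le) (hle β hβ T₀ hT₀)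
  · rw [ENNReal.lt_div_iff_mul_lt (Or.inl hW0) (Or.inl ENNReal.ofReal_ne_top),
      ← ENNReal.ofReal_mul hT₀.1.le, mul_comm,
      ENNReal.ofReal_lt_ofReal_iff (add_pos_of_nonneg_of_pos ENNReal.toReal_nonneg hε)] at hlt'
    exact hlt'

lemma tendsto_sqrt_floor_div {δ T₀ : ℝ} (hδ : 0 ≤ δ) (hT : 0 < T₀) :
    Tendsto (fun T : ℝ => Real.sqrt (δ * ⌊T / T₀⌋₊) / Real.sqrt T) atTop
      (𝓝 (Real.sqrt (δ / T₀))) := by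
  have h1 : Tendsto (fun T : ℝ => (⌊T₀⁻¹ * T⌋₊ : ℝ) / T) atTop (𝓝 T₀⁻¹) :=
    tendsto_nat_floor_mul_div_atTop (by positivity)
  have h2 := ((h1.const_mul δ).sqrt)
  rw [← div_eq_mul_inv] at h2
  refine h2.congr' ?_
  filter_upwards [eventually_gt_atTop 0] with T hT0
  rw [← Real.sqrt_div (by positivity), mul_div_assoc, div_eq_inv_mul T T₀]

lemma eventually_nearOptimal (S : SpectralMask)
    (hfeas : ∃ β ∈ Set.Icc (0 : ℝ) 1, ∃ T₀ : ℝ, S.Feasible β T₀) (hpos : 0 < S.minC)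
    {Nw Nb δ : ℝ} (hNw : 0 < Nw) (hNb : 0 < Nb) (hδ : δ ∈ Set.Ioo (0 : ℝ) 1)
    {Ω : Type*} [MeasurableSpace Ω] {P : Measure Ω} [IsProbabilityMeasure P]
    {B : L2 → Ω → ℝ} (hB : IsWGN P B Nb) {ε : ℝ} (hε : 0 < ε) :
    ∀ᶠ T : ℝ in atTop, ∃ (C : PAMCode T) (Γ : C.Decoder), NearOptimal S P B Nw δ
      (Nw / Nb * Real.sqrt (δ * S.W / S.minC.toReal))
      (max (1 - Nw / Nb) 0 * Real.sqrt (δ * S.W / S.minC.toReal)) ε T C Γ := by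
  obtain ⟨hδ0, hδ1⟩ := id hδ
  have hW := S.W_pos
  have hc0 : 0 < S.minC.toReal := by
    refine ENNReal.toReal_pos hpos.ne' ?_
    obtain ⟨β, hβ, T₀, h⟩ := hfeas
    have : S.minC ≤ ENNReal.ofReal S.W * ENNReal.ofReal T₀ :=
      (iInf₂_le β hβ).trans (mul_le_mul_right (iInf₂_le T₀ h) _)
    exact ne_top_of_le_ne_top (ENNReal.mul_ne_top ENNReal.ofReal_ne_top ENNReal.ofReal_ne_top) this
  set c := S.minC.toReal with hc
  set Q := Real.sqrt (δ * S.W / c) with hQ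
  have hQ0 : 0 ≤ Q := Real.sqrt_nonneg _
  set b := Nw / Nb with hb
  have hb0 : 0 < b := by positivity
  -- a pulse duration close to the optimal one
  have hcont : Tendsto (fun e : ℝ => Real.sqrt (δ * S.W / (c + e))) (𝓝[>] 0) (𝓝 Q) := by
    have : ContinuousAt (fun e : ℝ => Real.sqrt (δ * S.W / (c + e))) 0 := by
      refine ContinuousAt.sqrt (ContinuousAt.div (by fun_prop) (by fun_prop) ?_)
      simpa using hc0.ne'
    have h2 := this.tendsto
    simp only [add_zero] at h2
    exact h2.mono_left nhdsWithin_le_nhds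
  obtain ⟨e, he, he0⟩ := ((hcont.eventually (lt_mem_nhds
    (show Q - ε / (4 * b) < Q by linarith [show 0 < ε / (4 * b) by positivity]))).and
      self_mem_nhdsWithin).exists
  obtain ⟨β, hβ, T₀, hT₀, hcT, hTc⟩ := S.exists_feasible_lt hfeas (Set.mem_Ioi.mp he0)
  have hT0 : 0 < T₀ := hT₀.1
  set q := Real.sqrt (δ / T₀) with hq
  have hqeq : q = Real.sqrt (δ * S.W / (S.W * T₀)) := by
    rw [hq]; congr 1; field_simp
  have hqQ : q ≤ Q := by
    rw [hqeq, hQ]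
    exact Real.sqrt_le_sqrt (div_le_div_of_nonneg_left (by positivity) hc0 hcT)
  have hQq : Q - ε / (4 * b) < q := by
    refine he.trans_le ?_
    rw [hqeq]
    exact Real.sqrt_le_sqrt (div_le_div_of_nonneg_left (by positivity) (by positivity) hTc.le)
  -- the slack
  set η := min (1 / 16) (min (ε / 3) (ε / (4 * ((9 + 5 * b) * (Q + 1))))) with hη
  have hη0 : 0 < η := lt_min (by norm_num) (lt_min (by positivity) (by positivity))
  have hη16 : η ≤ 1 / 16 := min_le_left _ _
  have hη3 : η ≤ ε / 3 := (min_le_right _ _).trans (min_le_left _ _)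
  have hηQ : (9 + 5 * b) * η * Q ≤ ε / 4 := by
    have h1 : η ≤ ε / (4 * ((9 + 5 * b) * (Q + 1))) := (min_le_right _ _).trans (min_le_right _ _)
    rw [le_div_iff₀ (by positivity)] at h1
    have h2 : 0 ≤ (9 + 5 * b) * η := by positivity
    linarith
  -- With tolerance `κ = δ η`, the divergence is at most `(1 - η)² δ + δ η ≤ δ` and at least `δ - 3
  -- δ η ≥ δ - ε`.
  have hκ : 0 < δ * η := by positivity
  have hfloor : Tendsto (fun T : ℝ => ⌊T / T₀⌋₊) atTop atTop :=
    tendsto_nat_floor_atTop.comp (tendsto_id.atTop_div_const hT0)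
  have hlim := tendsto_sqrt_floor_div hδ0.le hT0
  have hlog : Tendsto (fun T : ℝ => Real.log 2 / Real.sqrt T) atTop (𝓝 0) :=
    tendsto_const_nhds.div_atTop Real.tendsto_sqrt_atTop
  have hrate : ∀ᶠ T : ℝ in atTop, b * Q - ε < (1 - 5 * η) * b *
      (Real.sqrt (δ * ⌊T / T₀⌋₊) / Real.sqrt T) - Real.log 2 / Real.sqrt T := by
    refine ((hlim.const_mul ((1 - 5 * η) * b)).sub hlog).eventually (lt_mem_nhds ?_)
    have h1 : b * Q - ε / 4 < b * q := by
      have := mul_lt_mul_of_pos_left hQq hb0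
      have h2 : b * (Q - ε / (4 * b)) = b * Q - ε / 4 := by field_simp
      linarith
    have h2 : 5 * b * η * q ≤ ε / 4 := by
      have h3 : 5 * b * η * q ≤ (9 + 5 * b) * η * Q := by
        refine mul_le_mul ?_ hqQ (Real.sqrt_nonneg _) (by positivity)
        exact mul_le_mul_of_nonneg_right (by linarith) hη0.le
      linarith
    rw [← hq]
    linarith
  have hkey : ∀ᶠ T : ℝ in atTop, (max (1 - b) 0 + (9 + 5 * b) * η) *
      (Real.sqrt (δ * ⌊T / T₀⌋₊) / Real.sqrt T) + Real.log 2 / Real.sqrt T <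
      max (1 - b) 0 * Q + ε := by
    refine ((hlim.const_mul (max (1 - b) 0 + (9 + 5 * b) * η)).add hlog).eventually
      (gt_mem_nhds ?_)
    rw [← hq]
    have h1 : (max (1 - b) 0 + (9 + 5 * b) * η) * q ≤ (max (1 - b) 0 + (9 + 5 * b) * η) * Q :=
      mul_le_mul_of_nonneg_left hqQ (add_nonneg (le_max_right _ _) (by positivity))
    linarith
  filter_upwards [hfloor.eventually (eventually_exists_signs hδ hNw hNb hη0 hη16 hκ),
    hfloor.eventually (eventually_gt_atTop 0), hrate, hkey, eventually_gt_atTop 0]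
    with T hT hn hr hk hTpos
  obtain ⟨k₁, k₂, a, ha, hk₁, hk₂, g, hinj, hlo, hup, herr⟩ := hT
  obtain ⟨Γ, hΓ⟩ := linearCode_perr_le (T := T) (a := a) hT0 hβ g hB hNb hη0.le
  have hsq : 0 < Real.sqrt T := Real.sqrt_pos.mpr hTpos
  have hδη : δ * η ≤ η := mul_le_of_le_one_left hη0.le hδ1.le
  have hδη2 : 0 ≤ δ * η ^ 2 := by positivity
  have hδη3 : δ * η ^ 2 ≤ δ * η := by
    refine mul_le_mul_of_nonneg_left ?_ hδ0.le
    rw [sq]; exact mul_le_of_le_one_left hη0.le (by linarith)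
  refine ⟨linearCode T hT0 hβ a k₁ k₂ g, Γ, linearCode_isBPSKRRC hT0 hβ g ha,
    linearCode_fits hT0 hβ g hT₀ ha hn hinj, ?_, ?_, ?_, ?_, ?_⟩
  · rw [linearCode_kl hT0 hβ g hNw]
    refine ENNReal.ofReal_le_ofReal (hup.trans ?_)
    linarith
  · rw [linearCode_kl hT0 hβ g hNw]
    refine ENNReal.ofReal_le_ofReal (le_trans ?_ hlo)
    linarith
  · have h1 : Real.log ((linearCode T hT0 hβ a k₁ k₂ g).M : ℝ) = k₁ * Real.log 2 := by
      simp [linearCode]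
    rw [h1]
    have h2 := div_le_div_of_nonneg_right hk₁ hsq.le
    rw [sub_div, mul_div_assoc] at h2
    linarith
  · have h1 : Real.log ((linearCode T hT0 hβ a k₁ k₂ g).K : ℝ) = k₂ * Real.log 2 := by
      simp [linearCode]
    rw [h1]
    have h2 := div_le_div_of_nonneg_right hk₂ hsq.le
    rw [← hb, add_div, mul_div_assoc (max (1 - b) 0 + (9 + 5 * b) * η)] at h2
    linarith
  · linarith

/-- At time `T` the finest tolerance `1 / (k + 1)` with `k ≤ ⌊T⌋` that already works is chosen; each
fixed tolerance is eventually available. -/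
lemma exists_diagonal {p : ℝ → ℝ → Prop} (h : ∀ ε > 0, ∀ᶠ T in atTop, p ε T) :
    ∃ e : ℝ → ℝ, Tendsto e atTop (𝓝 0) ∧ ∀ᶠ T in atTop, p (e T) T := by
  classical
  set f : ℕ → ℝ := fun k => 1 / ((k : ℝ) + 1) with hf
  have hf0 : ∀ k, 0 < f k := fun k => by positivity
  set k : ℝ → ℕ := fun T => Nat.findGreatest (fun k => p (f k) T) ⌊T⌋₊ with hk
  have hktop : Tendsto k atTop atTop := by
    refine tendsto_atTop.mpr fun m => ?_
    filter_upwards [h (f m) (hf0 m), eventually_ge_atTop (m : ℝ)] with T hT hmT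
    exact Nat.le_findGreatest (Nat.le_floor hmT) hT
  refine ⟨fun T => f (k T), tendsto_one_div_add_atTop_nhds_zero_nat.comp hktop, ?_⟩
  -- `Nat.findGreatest` returns `0` when no index works, so the property at index `0` is required.
  filter_upwards [h (f 0) (hf0 0)] with T hT
  exact Nat.findGreatest_spec (P := fun k => p (f k) T) (Nat.zero_le _) hT

/-- The code without carriers, with one message and one key. -/
def trivialCode (T : ℝ) : PAMCode T where
  n := 0
  M := 1
  K := 1
  M_pos := one_pos
  K_pos := one_pos
  carrier i := i.elim0
  carrier_memLp i := i.elim0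
  carrier_support i := i.elim0
  carrier_orthonormal i := i.elim0
  x _ _ i := i.elim0

end Main

end Covert

end

/-! ### Assembly of the code family -/

theorem theorem3 (S : Covert.SpectralMask)
    (hfeas : ∃ β ∈ Set.Icc (0 : ℝ) 1, ∃ T₀ : ℝ, S.Feasible β T₀) (hpos : 0 < S.minC)
    (Nw Nb δ : ℝ) (hNw : 0 < Nw) (hNb : 0 < Nb) (hδ : δ ∈ Set.Ioo (0 : ℝ) 1)
    {Ω : Type*} [MeasurableSpace Ω] (P : Measure Ω) [IsProbabilityMeasure P]
    (B : Covert.L2 → Ω → ℝ) (hB : Covert.IsWGN P B Nb) :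
    ∃ (C : ∀ T : ℝ, Covert.PAMCode T) (Γ : ∀ T : ℝ, (C T).Decoder),
      (∀ᶠ T : ℝ in atTop, (C T).IsBPSKRRC) ∧
      Covert.AchievesKL S P B Nw δ
        (Nw / Nb * Real.sqrt (δ * S.W / S.minC.toReal))
        (max (1 - Nw / Nb) 0 * Real.sqrt (δ * S.W / S.minC.toReal)) C Γ := by
  obtain ⟨e, he, hev⟩ := Covert.exists_diagonal fun ε hε =>
    Covert.eventually_nearOptimal S hfeas hpos hNw hNb hδ hB (ε := ε) hε
  set r := Nw / Nb * Real.sqrt (δ * S.W / S.minC.toReal)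
  set rK := max (1 - Nw / Nb) 0 * Real.sqrt (δ * S.W / S.minC.toReal)
  have hchoice : ∀ T : ℝ, ∃ (C : Covert.PAMCode T) (Γ : C.Decoder),
      (∃ (C : Covert.PAMCode T) (Γ : C.Decoder),
        Covert.NearOptimal S P B Nw δ r rK (e T) T C Γ) →
      Covert.NearOptimal S P B Nw δ r rK (e T) T C Γ := by
    intro T
    by_cases h : ∃ (C : Covert.PAMCode T) (Γ : C.Decoder),
        Covert.NearOptimal S P B Nw δ r rK (e T) T C Γ
    · obtain ⟨C, Γ, hΓ⟩ := h
      exact ⟨C, Γ, fun _ => hΓ⟩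
    · exact ⟨Covert.trivialCode T, ⟨fun _ _ => 0, fun _ => measurable_const⟩, fun h' => absurd h' h⟩
  choose C Γ hC using hchoice
  have hgood : ∀ᶠ T : ℝ in atTop, Covert.NearOptimal S P B Nw δ r rK (e T) T (C T) (Γ T) :=
    hev.mono fun T hT => hC T hT
  refine ⟨C, Γ, hgood.mono fun T h => h.bpsk, ?_, ?_, ?_, hgood.mono fun T h => h.kl_le,
    ⟨ENNReal.ofReal δ, le_rfl, ?_⟩, hgood.mono fun T h => h.fits⟩
  · refine le_of_forall_lt fun y hy => ?_
    obtain ⟨z, hyz, hzr⟩ := EReal.lt_iff_exists_real_btwn.mp hy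
    refine hyz.trans_le (le_liminf_of_le (by isBoundedDefault) ?_)
    have hz : 0 < r - z := sub_pos.mpr (EReal.coe_lt_coe_iff.mp hzr)
    filter_upwards [hgood, he.eventually (gt_mem_nhds hz)] with T hT heT
    exact EReal.coe_le_coe_iff.mpr (by linarith [hT.rate])
  · refine le_of_forall_gt fun y hy => ?_
    obtain ⟨z, hrz, hzy⟩ := EReal.lt_iff_exists_real_btwn.mp hy
    refine lt_of_le_of_lt (limsup_le_of_le (by isBoundedDefault) ?_) hzy
    have hz : 0 < z - rK := sub_pos.mpr (EReal.coe_lt_coe_iff.mp hrz)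
    filter_upwards [hgood, he.eventually (gt_mem_nhds hz)] with T hT heT
    exact EReal.coe_le_coe_iff.mpr (by linarith [hT.keyRate])
  · exact tendsto_of_tendsto_of_tendsto_of_le_of_le' tendsto_const_nhds he
      (.of_forall fun T => Covert.PAMCode.perr_nonneg (C T) P B (Γ T))
      (hgood.mono fun T h => h.perr_le)
  -- The divergence is squeezed between `δ - e T` and `δ`, so its limit is `δ` itself.
  · have hlow : Tendsto (fun T => ENNReal.ofReal (δ - e T)) atTop (𝓝 (ENNReal.ofReal δ)) := by
      have := ENNReal.tendsto_ofReal (tendsto_const_nhds (x := δ).sub he)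
      rwa [sub_zero] at this
    exact tendsto_of_tendsto_of_tendsto_of_le_of_le' hlow tendsto_const_nhds
      (hgood.mono fun T h => h.le_kl) (hgood.mono fun T h => h.kl_le)
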